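/- Work in ZFC. For a cardinal $\lambda$ let $H(\lambda)$ be the set of all sets whose transitive closure has fewer than $\lambda$ elements. Let $P$ be a partially ordered set. For a countable elementary substructure $N$ of $(H(\lambda),\in)$ with $P\in N$, a condition $p\in P$ is *$(N,P)$-generic* if for every dense set $E\subseteq P$ with $E\in N$, every $q\le p$ is compatible in $P$ with some element of $E\cap N$. The poset $P$ is *finitely proper* if for every regular cardinal $\lambda\ge\aleph_2$, every finite set $\{N_i : i<m\}$ of countable elementary substructures of $(H(\lambda),\in)$ with $P\in N_i$ for all $i<m$, and every $p\in P$ with $p\in N_i$ for all $i<m$, there is $p'\le p$ in $P$ that is $(N_i,P)$-generic for all $i<m$. $\mathrm{PFA}^\star(\omega_1)$ is the statement: for every finitely proper poset $P$ of cardinality exactly $\aleph_1$ and every family $\langle E_i : i<\omega_1\rangle$ of dense subsets of $P$ there is a filter $G\subseteq P$ with $G\cap E_i\neq\emptyset$ for all $i<\omega_1$. Let $\mathrm{Lim}(\omega_1)$ be the set of nonzero limit ordinals below $\omega_1$. A *ladder system* is a sequence $\langle A_\delta : \delta\in\mathrm{Lim}(\omega_1)\rangle$ such that each $A_\delta$ is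 a cofinal subset of $\delta$ of order type $\omega$. Miyamoto's principle $\mathrm{Code}(\text{even--odd})$ is the statement: for every ladder system $\langle A_\delta : \delta\in\mathrm{Lim}(\omega_1)\rangle$ and every $B\subseteq\omega_1$ there are closed unbounded sets $C\subseteq\omega_1$ and $D\subseteq\mathrm{Lim}(\omega_1)$ such that for every $\delta\in D$ the set $A_\delta\cap C$ is finite, and its cardinality is odd if $\delta\in B$ and even if $\delta\notin B$. **Proposition.** $\mathrm{PFA}^\star(\omega_1)$ implies $\mathrm{Code}(\text{even--odd})$. -/

import Mathlib

universe u

open Cardinal Ordinal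

/-!
Set theory is carried out in `ZFSet.{u}`, Mathlib's universe of ZFC sets: posets are sets, and the
structures `H(lam)` and their elementary substructures are formed with the true membership relation.
-/

/-- The relation symbols of the language of set theory: one binary symbol. -/
inductive SetTheoryRel : ℕ → Type
  | mem : SetTheoryRel 2

/-- The first-order language of set theory. -/
def setTheoryLanguage : FirstOrder.Language := ⟨fun _ => Empty, SetTheoryRel⟩

/-- `H(lam)`: the sets whose transitive closure has fewer than `lam` elements, that is, the sets
included in some transitive set with fewer than `lam` elements. -/
def hereditarySets (lam : Cardinal.{u}) : Set ZFSet.{u} :=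
  {x | ∃ t : ZFSet.{u}, t.IsTransitive ∧ x ⊆ t ∧ t.card < lam}

/-- Every collection of sets is a structure for the language of set theory, with true membership. -/
instance setTheoryStructure (S : Set ZFSet.{u}) : setTheoryLanguage.Structure S where
  funMap f := nomatch f
  RelMap | .mem => fun v => (v 0 : ZFSet.{u}) ∈ (v 1 : ZFSet.{u})

/-- `N` is a countable elementary substructure of `(H(lam), ∈)`. -/
def IsCountableElementary (lam : Cardinal.{u}) (N : Set ZFSet.{u}) : Prop :=
  N.Countable ∧
    ∃ S : setTheoryLanguage.ElementarySubstructure (hereditarySets lam),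
      N = Subtype.val '' (S : Set (hereditarySets lam))

/-- A partially ordered set in the universe of sets: an underlying set together with a set of
ordered pairs `(p, q)`, read `p ≤ q` (`p` extends `q`). -/
structure SetPoset : Type (u + 1) where
  carrier : ZFSet.{u}
  rel : ZFSet.{u}
  rel_subset : rel ⊆ carrier.prod carrier
  refl : ∀ p ∈ carrier, ZFSet.pair p p ∈ rel
  trans : ∀ p q r, ZFSet.pair p q ∈ rel → ZFSet.pair q r ∈ rel → ZFSet.pair p r ∈ rel
  antisymm : ∀ p q, ZFSet.pair p q ∈ rel → ZFSet.pair q p ∈ rel → p = q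

namespace SetPoset

/-- The poset as a single set, the ordered pair of its underlying set and its order. -/
def toZFSet (P : SetPoset.{u}) : ZFSet.{u} := ZFSet.pair P.carrier P.rel

/-- `p` extends `q`. -/
def Extends (P : SetPoset.{u}) (p q : ZFSet.{u}) : Prop := ZFSet.pair p q ∈ P.rel

/-- Two conditions are compatible if they have a common extension. -/
def Compatible (P : SetPoset.{u}) (p q : ZFSet.{u}) : Prop :=
  ∃ r, P.Extends r p ∧ P.Extends r q

/-- `E` is a dense subset of `P`. -/
def IsDense (P : SetPoset.{u}) (E : ZFSet.{u}) : Prop :=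
  E ⊆ P.carrier ∧ ∀ p ∈ P.carrier, ∃ e ∈ E, P.Extends e p

/-- `G` is a filter on `P`. -/
def IsFilter (P : SetPoset.{u}) (G : ZFSet.{u}) : Prop :=
  G ⊆ P.carrier ∧ G.Nonempty ∧
    (∀ p ∈ G, ∀ q, P.Extends p q → q ∈ G) ∧
    ∀ p ∈ G, ∀ q ∈ G, ∃ r ∈ G, P.Extends r p ∧ P.Extends r q

/-- `p` is `(N, P)`-generic: for every dense subset `E` of `P` that belongs to `N`, the set `E ∩ N`
is predense below `p`. -/
def IsGenericFor (P : SetPoset.{u}) (N : Set ZFSet.{u}) (p : ZFSet.{u}) : Prop :=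
  ∀ E ∈ N, P.IsDense E → ∀ q, P.Extends q p → ∃ e ∈ E, e ∈ N ∧ P.Compatible q e

/-- Finitely proper posets. -/
def FinitelyProper (P : SetPoset.{u}) : Prop :=
  ∀ lam : Cardinal.{u}, lam.IsRegular → ℵ_ 2 ≤ lam →
    ∀ F : Set (Set ZFSet.{u}), F.Finite →
      (∀ N ∈ F, IsCountableElementary lam N ∧ P.toZFSet ∈ N) →
      ∀ p ∈ P.carrier, (∀ N ∈ F, p ∈ N) →
        ∃ p', P.Extends p' p ∧ ∀ N ∈ F, P.IsGenericFor N p'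

end SetPoset

/-- The set `ω₁` of countable ordinals. -/
abbrev Omega1 : Type (u + 1) := Set.Iio (ω_ 1 : Ordinal.{u})

/-- The forcing axiom `FA(Γ)`: for every poset in `Γ` and every family of `ℵ₁` many dense subsets
of it there is a filter that meets all of them. -/
def ForcingAxiom (Γ : Set SetPoset.{u}) : Prop :=
  ∀ P ∈ Γ, ∀ E : Omega1.{u} → ZFSet.{u}, (∀ i, P.IsDense (E i)) →
    ∃ G, P.IsFilter G ∧ ∀ i, ∃ p ∈ G, p ∈ E i

/-- `PFA*(ω₁)`: the forcing axiom for the class of finitely proper posets of size `ℵ₁`. -/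
def PFAStar : Prop :=
  ForcingAxiom.{u} {P | P.FinitelyProper ∧ P.carrier.card = ℵ_ 1}

/-- `A` is a ladder system: for every limit ordinal `δ < ω₁`, `A δ` is a cofinal subset of `δ` of
order type `ω`. (The values of `A` at other ordinals are irrelevant.) -/
def IsLadderSystem (A : Omega1.{u} → Set Omega1.{u}) : Prop :=
  ∀ δ, Order.IsSuccLimit δ →
    (∀ α ∈ A δ, α < δ) ∧ (∀ β < δ, ∃ α ∈ A δ, β ≤ α) ∧ typeLT (A δ) = ω

/-- Miyamoto's principle `Code(even-odd)`. -/
def CodeEvenOdd : Prop :=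
  ∀ A : Omega1.{u} → Set Omega1.{u}, IsLadderSystem A → ∀ B : Set Omega1.{u},
    ∃ C D : Set Omega1.{u}, IsClub C ∧ IsClub D ∧
      ∀ δ ∈ D, Order.IsSuccLimit δ ∧ (A δ ∩ C).Finite ∧
        (δ ∈ B → Odd (A δ ∩ C).ncard) ∧ (δ ∉ B → Even (A δ ∩ C).ncard)

/-!
The forcing that codes `B` along the ladder system `A` has finite conditions with three components:
a finite set of points promised to the first club `C`, finitely many gaps `(a, b]` promised to be
disjoint from `C`, and a finite set of limit ordinals `δ` for which `A δ ∩ C` is promised to be its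
present finite part, which must have the parity prescribed by `B`. A filter meeting `ℵ₁` many dense
sets yields the club `C`, and `D` is the set of limit ordinals in `C`. The only density argument
with content is that a limit `δ` promised to `C` can be decided: if the parity is wrong, it is
corrected by a point of `A δ` close to `δ`, where nothing stands in the way because no gap crosses
`δ`, the ladders `A η` with `η < δ` end before `δ`, and those with `δ < η` have only finitely many
points below `δ` (`CodingCondition.exists_decided`).

For finite properness, let `N` be a countable elementary substructure and `δ = N ∩ ω₁`. A condition
is generic for `N` as soon as it promises `δ` to `C`, and a condition belonging to several models can
promise all their heights at once. Indeed, given a dense set `E ∈ N` and `q ∈ E` promising `δ`, no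
gap of `q` crosses `δ`, so an element of `E` below `δ` that extends the restriction of `q` to `δ` is
compatible with `q` unless its new points meet the ladders `A η` with `η ∈ q.decided`, `δ ≤ η`
(`CodingCondition.exists_le_of_le_restrict`). If `μ < δ` is closed under choosing, for each
restriction and each `γ`, an element of `E` with new points above `γ`, then such an element can be
found below `μ` with its new points above the finitely many points of these ladders below `μ`
(`CodingCondition.exists_club_predense`).

Apart from simple closure properties of `N`, elementarity enters only through one reflection
argument (`Omega1.reflection`): what holds at the limit points of some unbounded subset of `ω₁`
holds at `N ∩ ω₁`. All the data that this argument needs in `N`, namely the compatibility relation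
in terms of an enumeration of the conditions in type `ω₁`, and two operations forcing `N ∩ ω₁` to be
an initial segment of `ω₁`, are built into the sets that code the conditions (`codedPoset`), so that
they belong to every `N` that contains the poset.
-/

/-! ### Definability over `H(lam)` and elementary substructures -/

theorem hereditarySets_of_mem {lam : Cardinal.{u}} {x y : ZFSet.{u}}
    (hy : y ∈ hereditarySets lam) (hxy : x ∈ y) : x ∈ hereditarySets lam := by
  obtain ⟨t, ht, hyt, hc⟩ := hy
  exact ⟨t, ht, ht.subset_of_mem (hyt hxy), hc⟩

/-- A relation on `H(lam)` that is defined, without parameters, by a first-order formula of the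
language of set theory. The free variables are de Bruijn levels, so that quantifying out the last
variable matches `BoundedFormula.ex`. -/
def IsHDefinable (lam : Cardinal.{u}) {n : ℕ} (R : (Fin n → hereditarySets lam) → Prop) : Prop :=
  ∃ φ : setTheoryLanguage.BoundedFormula Empty n, ∀ v, φ.Realize default v ↔ R v

namespace IsHDefinable

variable {lam : Cardinal.{u}} {n : ℕ} {R R' : (Fin n → hereditarySets lam) → Prop}

theorem congr (h : IsHDefinable lam R) (hR : ∀ v, R v ↔ R' v) : IsHDefinable lam R' := by
  obtain ⟨φ, hφ⟩ := h
  exact ⟨φ, fun v => (hφ v).trans (hR v)⟩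

theorem mem (i j : Fin n) :
    IsHDefinable lam fun v => (v i : ZFSet.{u}) ∈ (v j : ZFSet.{u}) := by
  refine ⟨FirstOrder.Language.Relations.boundedFormula₂ (L := setTheoryLanguage)
    (SetTheoryRel.mem : setTheoryLanguage.Relations 2)
    (FirstOrder.Language.Term.var (Sum.inr i)) (FirstOrder.Language.Term.var (Sum.inr j)), ?_⟩
  intro v
  exact FirstOrder.Language.BoundedFormula.realize_rel₂.trans Iff.rfl

theorem eq (i j : Fin n) :
    IsHDefinable lam fun v => (v i : ZFSet.{u}) = (v j : ZFSet.{u}) := by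
  refine ⟨FirstOrder.Language.Term.bdEqual
    (FirstOrder.Language.Term.var (Sum.inr i)) (FirstOrder.Language.Term.var (Sum.inr j)), ?_⟩
  intro v
  rw [FirstOrder.Language.BoundedFormula.realize_bdEqual]
  exact Subtype.ext_iff

theorem imp (h : IsHDefinable lam R) (h' : IsHDefinable lam R') :
    IsHDefinable lam fun v => R v → R' v := by
  obtain ⟨φ, hφ⟩ := h
  obtain ⟨ψ, hψ⟩ := h'
  refine ⟨φ.imp ψ, fun v => ?_⟩
  rw [FirstOrder.Language.BoundedFormula.realize_imp, hφ, hψ]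

theorem and (h : IsHDefinable lam R) (h' : IsHDefinable lam R') :
    IsHDefinable lam fun v => R v ∧ R' v := by
  obtain ⟨φ, hφ⟩ := h
  obtain ⟨ψ, hψ⟩ := h'
  refine ⟨φ ⊓ ψ, fun v => ?_⟩
  rw [FirstOrder.Language.BoundedFormula.realize_inf, hφ, hψ]

theorem or (h : IsHDefinable lam R) (h' : IsHDefinable lam R') :
    IsHDefinable lam fun v => R v ∨ R' v := by
  obtain ⟨φ, hφ⟩ := h
  obtain ⟨ψ, hψ⟩ := h'
  refine ⟨φ ⊔ ψ, fun v => ?_⟩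
  rw [FirstOrder.Language.BoundedFormula.realize_sup, hφ, hψ]

theorem iff (h : IsHDefinable lam R) (h' : IsHDefinable lam R') :
    IsHDefinable lam fun v => (R v ↔ R' v) :=
  ((h.imp h').and (h'.imp h)).congr fun _ => iff_iff_implies_and_implies.symm

theorem all {Q : (Fin n → hereditarySets lam) → hereditarySets lam → Prop}
    (h : IsHDefinable lam fun w : Fin (n + 1) → hereditarySets lam =>
      Q (fun i => w i.castSucc) (w (Fin.last n))) :
    IsHDefinable lam fun v => ∀ x, Q v x := by
  obtain ⟨φ, hφ⟩ := h
  refine ⟨φ.all, fun v => ?_⟩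
  rw [FirstOrder.Language.BoundedFormula.realize_all]
  refine forall_congr' fun x => (hφ _).trans ?_
  simp only [Fin.snoc_castSucc, Fin.snoc_last]

theorem ex {Q : (Fin n → hereditarySets lam) → hereditarySets lam → Prop}
    (h : IsHDefinable lam fun w : Fin (n + 1) → hereditarySets lam =>
      Q (fun i => w i.castSucc) (w (Fin.last n))) :
    IsHDefinable lam fun v => ∃ x, Q v x := by
  obtain ⟨φ, hφ⟩ := h
  refine ⟨φ.ex, fun v => ?_⟩
  rw [FirstOrder.Language.BoundedFormula.realize_ex]
  refine exists_congr fun x => (hφ _).trans ?_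
  simp only [Fin.snoc_castSucc, Fin.snoc_last]

theorem unorderedPair (k i j : Fin n) :
    IsHDefinable lam fun v => (v k : ZFSet.{u}) = {(v i : ZFSet.{u}), (v j : ZFSet.{u})} := by
  refine (IsHDefinable.all (Q := fun v s => (s : ZFSet.{u}) ∈ (v k : ZFSet.{u}) ↔
    (s : ZFSet.{u}) = (v i : ZFSet.{u}) ∨ (s : ZFSet.{u}) = (v j : ZFSet.{u}))
    ((mem _ _).iff ((eq _ _).or (eq _ _)))).congr fun v => ?_
  constructor
  · intro h
    ext s
    rw [ZFSet.mem_pair]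
    constructor
    · intro hs
      exact (h ⟨s, hereditarySets_of_mem (v k).2 hs⟩).1 hs
    · rintro (rfl | rfl)
      · exact (h (v i)).2 (Or.inl rfl)
      · exact (h (v j)).2 (Or.inr rfl)
  · intro h s
    rw [h, ZFSet.mem_pair]

theorem pair (k i j : Fin n) :
    IsHDefinable lam fun v => (v k : ZFSet.{u}) = ZFSet.pair (v i) (v j) := by
  refine (((IsHDefinable.ex (Q := fun v t => (t : ZFSet.{u}) ∈ (v k : ZFSet.{u}) ∧
      (t : ZFSet.{u}) = {(v i : ZFSet.{u}), (v i : ZFSet.{u})})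
      ((mem _ _).and (unorderedPair _ _ _))).and
    (IsHDefinable.ex (Q := fun v t => (t : ZFSet.{u}) ∈ (v k : ZFSet.{u}) ∧
      (t : ZFSet.{u}) = {(v i : ZFSet.{u}), (v j : ZFSet.{u})})
      ((mem _ _).and (unorderedPair _ _ _)))).and
    (IsHDefinable.all (Q := fun v t => (t : ZFSet.{u}) ∈ (v k : ZFSet.{u}) →
      ((t : ZFSet.{u}) = {(v i : ZFSet.{u}), (v i : ZFSet.{u})} ∨
        (t : ZFSet.{u}) = {(v i : ZFSet.{u}), (v j : ZFSet.{u})}))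
      ((mem _ _).imp ((unorderedPair _ _ _).or (unorderedPair _ _ _))))).congr fun v => ?_
  rw [ZFSet.pair]
  constructor
  · rintro ⟨⟨⟨t, ht, ht'⟩, ⟨s, hs, hs'⟩⟩, h⟩
    ext z
    rw [ZFSet.mem_pair, ← ZFSet.pair_eq_singleton]
    constructor
    · intro hz
      exact h ⟨z, hereditarySets_of_mem (v k).2 hz⟩ hz
    · rintro (rfl | rfl)
      · rwa [← ht']
      · rwa [← hs']
  · intro h
    have h1 : ({(v i : ZFSet.{u})} : ZFSet.{u}) ∈ (v k : ZFSet.{u}) := by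
      rw [h, ZFSet.mem_pair]; exact Or.inl rfl
    have h2 : ({(v i : ZFSet.{u}), (v j : ZFSet.{u})} : ZFSet.{u}) ∈ (v k : ZFSet.{u}) := by
      rw [h, ZFSet.mem_pair]; exact Or.inr rfl
    refine ⟨⟨⟨⟨_, hereditarySets_of_mem (v k).2 h1⟩, h1, (ZFSet.pair_eq_singleton _).symm⟩,
      ⟨⟨_, hereditarySets_of_mem (v k).2 h2⟩, h2, rfl⟩⟩, fun t ht => ?_⟩
    rwa [h, ZFSet.mem_pair, ← ZFSet.pair_eq_singleton] at ht

theorem triple (l i j k : Fin n) :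
    IsHDefinable lam fun v =>
      (v l : ZFSet.{u}) = ZFSet.pair (v i) (ZFSet.pair (v j) (v k)) := by
  refine (IsHDefinable.ex (Q := fun v p => (p : ZFSet.{u}) = ZFSet.pair (v j) (v k) ∧
    (v l : ZFSet.{u}) = ZFSet.pair (v i) p) ((pair _ _ _).and (pair _ _ _))).congr fun v => ?_
  constructor
  · rintro ⟨p, hp, h⟩
    rw [h, hp]
  · intro h
    have h2 : ({(v i : ZFSet.{u}), ZFSet.pair (v j) (v k)} : ZFSet.{u}) ∈ (v l : ZFSet.{u}) := by
      rw [h, ZFSet.pair, ZFSet.mem_pair]; exact Or.inr rfl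
    have h3 : ZFSet.pair (v j : ZFSet.{u}) (v k) ∈
        ({(v i : ZFSet.{u}), ZFSet.pair (v j) (v k)} : ZFSet.{u}) := by
      rw [ZFSet.mem_pair]; exact Or.inr rfl
    exact ⟨⟨_, hereditarySets_of_mem (hereditarySets_of_mem (v l).2 h2) h3⟩, rfl, h⟩

/-- The Tarski–Vaught property: a definable relation with parameters in an elementary substructure
`N` that has a witness in `H(lam)` has one in `N`. -/
theorem exists_mem {N : Set ZFSet.{u}} (hN : IsCountableElementary lam N)
    {Q : (Fin n → hereditarySets lam) → hereditarySets lam → Prop}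
    (h : IsHDefinable lam fun w : Fin (n + 1) → hereditarySets lam =>
      Q (fun i => w i.castSucc) (w (Fin.last n)))
    (v : Fin n → hereditarySets lam) (hv : ∀ i, (v i : ZFSet.{u}) ∈ N) (hx : ∃ x, Q v x) :
    ∃ x : hereditarySets lam, (x : ZFSet.{u}) ∈ N ∧ Q v x := by
  obtain ⟨-, S, rfl⟩ := hN
  have hv' : ∀ i, v i ∈ S := fun i => by
    obtain ⟨y, hy, hyv⟩ := hv i
    rwa [Subtype.ext hyv] at hy
  obtain ⟨φ, hφ⟩ := h
  let v₀ : Fin n → S := fun i => ⟨v i, hv' i⟩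
  have hd : (S.subtype ∘ (default : Empty → S)) = (default : Empty → hereditarySets lam) :=
    Subsingleton.elim _ _
  have h1 : φ.ex.Realize (default : Empty → hereditarySets lam) v := by
    rw [FirstOrder.Language.BoundedFormula.realize_ex]
    obtain ⟨x, hx⟩ := hx
    refine ⟨x, (hφ _).2 ?_⟩
    simpa only [Fin.snoc_castSucc, Fin.snoc_last] using hx
  have h2 : φ.ex.Realize (default : Empty → S) v₀ := by
    rw [← S.subtype.map_boundedFormula, hd]
    exact h1
  rw [FirstOrder.Language.BoundedFormula.realize_ex] at h2
  obtain ⟨x, hx⟩ := h2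
  rw [← S.subtype.map_boundedFormula, hd, hφ] at hx
  refine ⟨x, ⟨x, x.2, rfl⟩, ?_⟩
  have e1 : (fun i : Fin n => (S.subtype ∘ (Fin.snoc v₀ x : Fin (n + 1) → S)) i.castSucc) = v := by
    funext i
    simp only [Function.comp_apply, Fin.snoc_castSucc]
    rfl
  have e2 : (S.subtype ∘ (Fin.snoc v₀ x : Fin (n + 1) → S)) (Fin.last n) = x := by
    simp only [Function.comp_apply, Fin.snoc_last]
    rfl
  rwa [e1, e2] at hx

end IsHDefinable

namespace IsCountableElementary

variable {lam : Cardinal.{u}} {N : Set ZFSet.{u}}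

theorem subset_hereditarySets (hN : IsCountableElementary lam N) : N ⊆ hereditarySets lam := by
  obtain ⟨-, S, rfl⟩ := hN
  rintro _ ⟨x, -, rfl⟩
  exact x.2

theorem exists_mem_of_nonempty (hN : IsCountableElementary lam N) {x y : ZFSet.{u}} (hx : x ∈ N)
    (hy : y ∈ x) : ∃ z ∈ N, z ∈ x := by
  have hxH := hN.subset_hereditarySets hx
  obtain ⟨z, hz, hzx⟩ := IsHDefinable.exists_mem hN
    (Q := fun v s => (s : ZFSet.{u}) ∈ (v 0 : ZFSet.{u})) (IsHDefinable.mem _ _)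
    ![⟨x, hxH⟩] (by simpa using hx) ⟨⟨y, hereditarySets_of_mem hxH hy⟩, hy⟩
  exact ⟨z, hz, hzx⟩

theorem mem_of_pair_mem (hN : IsCountableElementary lam N) {x y : ZFSet.{u}}
    (h : ZFSet.pair x y ∈ N) : x ∈ N ∧ y ∈ N := by
  have hH := hN.subset_hereditarySets h
  have hs : ({x, y} : ZFSet.{u}) ∈ hereditarySets lam :=
    hereditarySets_of_mem hH (by rw [ZFSet.pair, ZFSet.mem_pair]; exact Or.inr rfl)
  have hx : x ∈ hereditarySets lam := hereditarySets_of_mem hs (ZFSet.mem_pair.2 (Or.inl rfl))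
  have hy : y ∈ hereditarySets lam := hereditarySets_of_mem hs (ZFSet.mem_pair.2 (Or.inr rfl))
  constructor
  · obtain ⟨z, hz, w, hw⟩ := IsHDefinable.exists_mem hN
      (Q := fun v s => ∃ w : hereditarySets lam, (v 0 : ZFSet.{u}) = ZFSet.pair s w)
      (IsHDefinable.ex (IsHDefinable.pair _ _ _))
      ![⟨_, hH⟩] (by simpa using h) ⟨⟨x, hx⟩, ⟨y, hy⟩, rfl⟩
    rwa [(ZFSet.pair_inj.1 hw).1]
  · obtain ⟨z, hz, w, hw⟩ := IsHDefinable.exists_mem hN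
      (Q := fun v s => ∃ w : hereditarySets lam, (v 0 : ZFSet.{u}) = ZFSet.pair w s)
      (IsHDefinable.ex (IsHDefinable.pair _ _ _))
      ![⟨_, hH⟩] (by simpa using h) ⟨⟨y, hy⟩, ⟨x, hx⟩, rfl⟩
    rwa [(ZFSet.pair_inj.1 hw).2]

theorem pair_mem (hN : IsCountableElementary lam N) {x y : ZFSet.{u}} (hx : x ∈ N) (hy : y ∈ N)
    (h : ZFSet.pair x y ∈ hereditarySets lam) : ZFSet.pair x y ∈ N := by
  obtain ⟨z, hz, hzx⟩ := IsHDefinable.exists_mem hN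
    (Q := fun v s => (s : ZFSet.{u}) = ZFSet.pair (v 0) (v 1)) (IsHDefinable.pair _ _ _)
    ![⟨x, hN.subset_hereditarySets hx⟩, ⟨y, hN.subset_hereditarySets hy⟩]
    (by simpa [Fin.forall_fin_two] using ⟨hx, hy⟩) ⟨⟨_, h⟩, rfl⟩
  have : (z : ZFSet.{u}) = ZFSet.pair x y := hzx
  rwa [← this]

/-- An elementary substructure is closed under every function whose graph it contains. -/
theorem exists_mem_of_triple_mem (hN : IsCountableElementary lam N) {T x y z : ZFSet.{u}}
    (hT : T ∈ N) (hx : x ∈ N) (hy : y ∈ N) (h : ZFSet.pair x (ZFSet.pair y z) ∈ T) :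
    ∃ w ∈ N, ZFSet.pair x (ZFSet.pair y w) ∈ T := by
  have hTH := hN.subset_hereditarySets hT
  have hH := hereditarySets_of_mem hTH h
  have h1 := hereditarySets_of_mem (y := {x, ZFSet.pair y z}) (x := ZFSet.pair y z)
    (hereditarySets_of_mem hH (by rw [ZFSet.pair, ZFSet.mem_pair]; exact Or.inr rfl))
    (ZFSet.mem_pair.2 (Or.inr rfl))
  have h2 := hereditarySets_of_mem (y := {y, z}) (x := z)
    (hereditarySets_of_mem h1 (by rw [ZFSet.pair, ZFSet.mem_pair]; exact Or.inr rfl))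
    (ZFSet.mem_pair.2 (Or.inr rfl))
  obtain ⟨w, hw, t, ht, hQ⟩ := IsHDefinable.exists_mem hN
    (Q := fun v s => ∃ t : hereditarySets lam, (t : ZFSet.{u}) ∈ (v 0 : ZFSet.{u}) ∧
      (t : ZFSet.{u}) = ZFSet.pair (v 1) (ZFSet.pair (v 2) s))
    (IsHDefinable.ex ((IsHDefinable.mem _ _).and (IsHDefinable.triple _ _ _ _)))
    ![⟨T, hTH⟩, ⟨x, hN.subset_hereditarySets hx⟩, ⟨y, hN.subset_hereditarySets hy⟩]
    (by simpa [Fin.forall_fin_succ] using ⟨hT, hx, hy⟩) ⟨⟨z, h2⟩, ⟨_, hH⟩, h, rfl⟩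
  refine ⟨w, hw, ?_⟩
  have h3 : (t : ZFSet.{u}) = ZFSet.pair x (ZFSet.pair y w) := hQ
  rw [← h3]
  exact ht

end IsCountableElementary

/-! ### The order type `ω₁` -/

namespace Omega1

theorem exists_forall_lt {s : Set Omega1.{u}} (hs : s.Countable) : ∃ z, ∀ x ∈ s, x < z := by
  have : Countable s := hs
  have h : ⨆ x : s, Order.succ (x.1.1 : Ordinal.{u}) < ω_ 1 :=
    Ordinal.iSup_lt_omega_one fun x => (Cardinal.isSuccLimit_omega 1).succ_lt x.1.2
  refine ⟨⟨_, h⟩, fun x hx => ?_⟩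
  have hb : BddAbove (Set.range fun x : s => Order.succ (x.1.1 : Ordinal.{u})) :=
    ⟨ω_ 1, by rintro _ ⟨y, rfl⟩; exact ((Cardinal.isSuccLimit_omega 1).succ_lt y.1.2).le⟩
  exact Subtype.mk_lt_mk.2 ((Order.lt_succ x.1).trans_le (le_ciSup hb ⟨x, hx⟩))

theorem exists_gt (x : Omega1.{u}) : ∃ z, x < z := by
  obtain ⟨z, hz⟩ := exists_forall_lt (Set.countable_singleton x)
  exact ⟨z, hz x rfl⟩

theorem mk_eq : #Omega1.{u} = Cardinal.lift.{u + 1} (ℵ_ 1 : Cardinal.{u}) := by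
  rw [Cardinal.mk_Iio_ordinal, Ordinal.card_omega]

theorem countable_Iio (x : Omega1.{u}) : (Set.Iio x).Countable := by
  have h1 : (Set.Iio x.1).Countable := by
    rw [← Cardinal.le_aleph0_iff_set_countable, Cardinal.mk_Iio_ordinal, Cardinal.lift_le_aleph0,
      ← Order.lt_succ_iff, Cardinal.succ_aleph0]
    exact Cardinal.lt_omega_iff_card_lt.1 x.2
  exact (h1.preimage Subtype.val_injective).mono fun y hy => hy

theorem countable_Iic (x : Omega1.{u}) : (Set.Iic x).Countable := by
  obtain ⟨z, hz⟩ := exists_gt x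
  exact (countable_Iio z).mono fun y hy => lt_of_le_of_lt hy hz

theorem not_countable : ¬ (Set.univ : Set Omega1.{u}).Countable := fun h => by
  obtain ⟨z, hz⟩ := exists_forall_lt h
  exact lt_irrefl z (hz z trivial)

/-- The limit ordinals below `ω₁` that are closed under a binary operation are unbounded. -/
theorem isCofinal_closed (f : Omega1.{u} → Omega1.{u} → Omega1.{u}) :
    IsCofinal {μ : Omega1.{u} | Order.IsSuccLimit μ ∧ ∀ x < μ, ∀ y < μ, f x y < μ} := by
  intro z₀
  have hb : ∀ z : Omega1.{u}, ∃ b, z < b ∧ ∀ x ≤ z, ∀ y ≤ z, f x y < b := by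
    intro z
    obtain ⟨b, hb⟩ := exists_forall_lt
      (((countable_Iic z).image2 (countable_Iic z) f).union (Set.countable_singleton z))
    exact ⟨b, hb z (Or.inr rfl), fun x hx y hy => hb _ (Or.inl ⟨x, hx, y, hy, rfl⟩)⟩
  choose b hb₁ hb₂ using hb
  let a : ℕ → Omega1.{u} := fun n => b^[n] z₀
  have ha : ∀ n, a (n + 1) = b (a n) := fun n => Function.iterate_succ_apply' b n z₀
  have hmono : Monotone a := monotone_nat_of_le_succ fun n => by
    rw [ha]; exact (hb₁ _).le
  have hex : ∃ m, ∀ n, a n < m := by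
    obtain ⟨m, hm⟩ := exists_forall_lt (Set.countable_range a)
    exact ⟨m, fun n => hm _ ⟨n, rfl⟩⟩
  obtain ⟨μ, hμ, hmin⟩ := WellFounded.has_min wellFounded_lt {m | ∀ n, a n < m} hex
  have hlt : ∀ x < μ, ∃ n, x ≤ a n := by
    intro x hx
    by_contra! h
    exact hmin x h hx
  refine ⟨μ, ⟨⟨fun h => ?_, fun x hx => ?_⟩, fun x hx y hy => ?_⟩, (hμ 0).le⟩
  · exact (h (hμ 0).le).not_gt (hμ 0)
  · obtain ⟨n, hn⟩ := hlt x hx.lt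
    refine hx.2 (lt_of_le_of_lt hn ?_) (hμ (n + 1))
    rw [ha]
    exact hb₁ _
  · obtain ⟨n, hn⟩ := hlt x hx
    obtain ⟨m, hm⟩ := hlt y hy
    refine lt_trans ?_ (hμ (max n m + 1))
    rw [ha]
    exact hb₂ _ _ (hn.trans (hmono (le_max_left _ _))) _ (hm.trans (hmono (le_max_right _ _)))

/-- Two binary operations on `ω₁` such that every nonempty set closed under both is an initial
segment: the first generates infinitely many codes of natural numbers, the second enumerates,
along these codes, the predecessors of its second argument. -/
theorem exists_generating_operations :
    ∃ T₁ T₂ : Omega1.{u} → Omega1.{u} → Omega1.{u}, ∀ A : Set Omega1.{u}, A.Nonempty →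
      (∀ a ∈ A, ∀ b ∈ A, T₁ a b ∈ A ∧ T₂ a b ∈ A) → IsLowerSet A := by
  classical
  obtain ⟨z, -⟩ : ∃ z : Omega1.{u}, ∀ x ∈ (∅ : Set Omega1.{u}), x < z :=
    exists_forall_lt Set.countable_empty
  choose s hs using exists_gt.{u}
  let c : ℕ → Omega1.{u} := fun n => s^[n] z
  have hc : ∀ n, c (n + 1) = s (c n) := fun n => Function.iterate_succ_apply' s n z
  have hcinj : Function.Injective c :=
    (strictMono_nat_of_lt_succ fun n => by rw [hc]; exact hs _).injective
  have he : ∀ b : Omega1.{u}, ∃ e : ℕ → Omega1.{u}, ∀ x ≤ b, ∃ n, e n = x := by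
    intro b
    obtain ⟨e, he⟩ := (countable_Iic b).exists_eq_range ⟨b, Set.mem_Iic.2 le_rfl⟩
    exact ⟨e, fun x hx => by have : x ∈ Set.Iic b := hx; rwa [he] at this⟩
  choose e he using he
  refine ⟨fun a b => if a = b then s a else z, fun a b => e b (Function.invFun c a), ?_⟩
  rintro A ⟨a, ha⟩ hA
  have hsucc : ∀ a ∈ A, s a ∈ A := fun a ha => by simpa using (hA a ha a ha).1
  have hz : z ∈ A := by
    have := (hA _ (hsucc a ha) a ha).1
    simpa [(hs a).ne'] using this
  have hcA : ∀ n, c n ∈ A := by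
    intro n
    induction n with
    | zero => exact hz
    | succ n ih => rw [hc]; exact hsucc _ ih
  intro b x hxb hb
  obtain ⟨n, rfl⟩ := he b x hxb
  have := (hA _ (hcA n) b hb).2
  simpa [Function.leftInverse_invFun hcinj n] using this

/-- The von Neumann ordinal `ω₁`. -/
noncomputable def zfSet : ZFSet.{u} := (ω_ 1 : Ordinal.{u}).toZFSet

theorem mem_zfSet_iff {x : ZFSet.{u}} : x ∈ zfSet.{u} ↔ ∃ a : Omega1.{u}, a.1.toZFSet = x := by
  rw [zfSet, Ordinal.mem_toZFSet_iff]
  exact ⟨fun ⟨a, ha, h⟩ => ⟨⟨a, ha⟩, h⟩, fun ⟨a, h⟩ => ⟨a.1, a.2, h⟩⟩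

theorem toZFSet_mem_zfSet (a : Omega1.{u}) : a.1.toZFSet ∈ zfSet.{u} := mem_zfSet_iff.2 ⟨a, rfl⟩

theorem toZFSet_inj {a b : Omega1.{u}} : a.1.toZFSet = b.1.toZFSet ↔ a = b :=
  Ordinal.toZFSet_injective.eq_iff.trans Subtype.ext_iff.symm

/-- A ternary relation on `ω₁` as a set of ordered triples. -/
noncomputable def relSet (R : Omega1.{u} → Omega1.{u} → Omega1.{u} → Prop) : ZFSet.{u} :=
  ZFSet.range fun t : {t : Omega1.{u} × Omega1.{u} × Omega1.{u} // R t.1 t.2.1 t.2.2} =>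
    ZFSet.pair t.1.1.1.toZFSet (ZFSet.pair t.1.2.1.1.toZFSet t.1.2.2.1.toZFSet)

theorem triple_mem_relSet {R : Omega1.{u} → Omega1.{u} → Omega1.{u} → Prop} {a b : Omega1.{u}}
    {z : ZFSet.{u}} : ZFSet.pair a.1.toZFSet (ZFSet.pair b.1.toZFSet z) ∈ relSet R ↔
      ∃ c : Omega1.{u}, c.1.toZFSet = z ∧ R a b c := by
  rw [relSet, ZFSet.mem_range]
  constructor
  · rintro ⟨⟨⟨a', b', c⟩, h⟩, ht⟩
    obtain ⟨h1, h2⟩ := ZFSet.pair_inj.1 ht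
    obtain ⟨h2, h3⟩ := ZFSet.pair_inj.1 h2
    obtain rfl := toZFSet_inj.1 h1
    obtain rfl := toZFSet_inj.1 h2
    exact ⟨c, h3, h⟩
  · rintro ⟨c, rfl, h⟩
    exact ⟨⟨⟨a, b, c⟩, h⟩, rfl⟩

end Omega1

/-! ### Reflection at `N ∩ ω₁` -/

namespace Omega1

/-- The set `ω₁` together with three ternary relations on it, as a single set. -/
noncomputable def paramSet (T₁ T₂ W : Omega1.{u} → Omega1.{u} → Omega1.{u} → Prop) : ZFSet.{u} :=
  ZFSet.pair zfSet (ZFSet.pair (relSet T₁) (ZFSet.pair (relSet T₂) (relSet W)))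

/-- If `N` contains `ω₁` and a generating pair of operations on it, then `N ∩ ω₁` is a nonzero
countable ordinal. -/
theorem exists_height {lam : Cardinal.{u}} {N : Set ZFSet.{u}} (hN : IsCountableElementary lam N)
    {T₁ T₂ : Omega1.{u} → Omega1.{u} → Omega1.{u}}
    (hT : ∀ A : Set Omega1.{u}, A.Nonempty →
      (∀ a ∈ A, ∀ b ∈ A, T₁ a b ∈ A ∧ T₂ a b ∈ A) → IsLowerSet A)
    (hω : zfSet ∈ N) (h₁ : relSet (fun a b c => T₁ a b = c) ∈ N)
    (h₂ : relSet (fun a b c => T₂ a b = c) ∈ N) :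
    ∃ δ : Omega1.{u}, (∃ a, a < δ) ∧ ∀ a : Omega1.{u}, a.1.toZFSet ∈ N ↔ a < δ := by
  let A : Set Omega1.{u} := {a | a.1.toZFSet ∈ N}
  have hclosed : ∀ T : Omega1.{u} → Omega1.{u} → Omega1.{u},
      relSet (fun a b c => T a b = c) ∈ N → ∀ a ∈ A, ∀ b ∈ A, T a b ∈ A := by
    intro T hT a ha b hb
    obtain ⟨w, hw, hw'⟩ := hN.exists_mem_of_triple_mem hT ha hb
      (triple_mem_relSet.2 ⟨T a b, rfl, rfl⟩)
    obtain ⟨c, rfl, hc⟩ := triple_mem_relSet.1 hw'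
    rw [hc]
    exact hw
  have hne : A.Nonempty := by
    obtain ⟨z, -⟩ := exists_forall_lt.{u} Set.countable_empty
    obtain ⟨w, hw, hw'⟩ := hN.exists_mem_of_nonempty hω (toZFSet_mem_zfSet z)
    obtain ⟨a, rfl⟩ := mem_zfSet_iff.1 hw'
    exact ⟨a, hw⟩
  have hlow : IsLowerSet A :=
    hT A hne fun a ha b hb => ⟨hclosed T₁ h₁ a ha b hb, hclosed T₂ h₂ a ha b hb⟩
  have hcount : A.Countable :=
    hN.1.preimage (f := fun a : Omega1.{u} => a.1.toZFSet) fun a b h => toZFSet_inj.1 h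
  obtain ⟨z, hz⟩ := exists_forall_lt hcount
  obtain ⟨δ, hδ, hmin⟩ := WellFounded.has_min wellFounded_lt Aᶜ ⟨z, fun h => lt_irrefl _ (hz z h)⟩
  have hiff : ∀ a : Omega1.{u}, a.1.toZFSet ∈ N ↔ a < δ := by
    intro a
    constructor
    · intro ha
      by_contra h
      exact hδ (hlow (not_lt.1 h) ha)
    · intro ha
      by_contra h
      exact hmin a h ha
  obtain ⟨a, ha⟩ := hne
  exact ⟨δ, ⟨a, (hiff a).1 ha⟩, hiff⟩

theorem subset_zfSet_mem_hereditarySets {lam : Cardinal.{u}} (hlam : ℵ_ 1 < lam) {x : ZFSet.{u}}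
    (hx : x ⊆ zfSet) : x ∈ hereditarySets lam := by
  refine ⟨zfSet, (ZFSet.isOrdinal_toZFSet _).isTransitive, hx, ?_⟩
  rwa [zfSet, Ordinal.card_toZFSet, Ordinal.card_omega]

/-- A statement about the parameters `W`, `E`, `S` and an ordinal `α` that holds at all limit points
`α` of an unbounded subset of `ω₁` also holds at `α = N ∩ ω₁`, provided that the parameters belong
to `N`: by elementarity, `N` contains an unbounded subset of `ω₁` at the limit points of which the
statement holds, and `N ∩ ω₁` is a limit point of it. The class of statements is just what is
needed for genericity; `ZFSet.pair j S` is the condition with index `j`. -/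
theorem reflection {lam : Cardinal.{u}} (hlam : ℵ_ 1 < lam) {N : Set ZFSet.{u}}
    (hN : IsCountableElementary lam N) {W : Omega1.{u} → Omega1.{u} → Omega1.{u} → Prop}
    {E S : ZFSet.{u}} (hω : zfSet ∈ N) (hW : relSet W ∈ N) (hE : E ∈ N) (hS : S ∈ N)
    {δ : Omega1.{u}} (hδ₀ : ∃ a, a < δ) (hδ : ∀ a : Omega1.{u}, a.1.toZFSet ∈ N ↔ a < δ)
    {C : Set Omega1.{u}} (hC : IsCofinal C)
    (h : ∀ α : Omega1.{u}, (∃ a, a < α) → (∀ β < α, ∃ γ ∈ C, β < γ ∧ γ < α) →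
      ∀ i, ∃ j, ZFSet.pair j.1.toZFSet S ∈ E ∧ W α i j) :
    ∀ i, ∃ j : Omega1.{u}, ZFSet.pair j.1.toZFSet S ∈ E ∧ W δ i j := by
  classical
  -- The statement that `c` is unbounded and that its limit points have the required property;
  -- `v 0, v 1, v 2, v 3` stand for `ω₁`, `E`, `S` and `W`.
  let Q : (Fin 4 → hereditarySets lam) → hereditarySets lam → Prop := fun v c =>
    (∀ b : hereditarySets lam, b.1 ∈ (v 0).1 →
      ∃ g : hereditarySets lam, g.1 ∈ c.1 ∧ g.1 ∈ (v 0).1 ∧ b.1 ∈ g.1) ∧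
    ∀ a : hereditarySets lam, a.1 ∈ (v 0).1 → (∃ b : hereditarySets lam, b.1 ∈ a.1) →
      (∀ b : hereditarySets lam, b.1 ∈ a.1 →
        ∃ g : hereditarySets lam, g.1 ∈ c.1 ∧ b.1 ∈ g.1 ∧ g.1 ∈ a.1) →
      ∀ i : hereditarySets lam, i.1 ∈ (v 0).1 → ∃ j e t : hereditarySets lam,
        e.1 ∈ (v 1).1 ∧ e.1 = ZFSet.pair j.1 (v 2).1 ∧ t.1 ∈ (v 3).1 ∧
          t.1 = ZFSet.pair a.1 (ZFSet.pair i.1 j.1)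
  have hQ : IsHDefinable lam fun w : Fin 5 → hereditarySets lam =>
      Q (fun i => w i.castSucc) (w (Fin.last 4)) := by
    refine IsHDefinable.and
      (IsHDefinable.all ((IsHDefinable.mem _ _).imp (IsHDefinable.ex
        ((IsHDefinable.mem _ _).and ((IsHDefinable.mem _ _).and (IsHDefinable.mem _ _))))))
      (IsHDefinable.all ((IsHDefinable.mem _ _).imp (IsHDefinable.imp
        (IsHDefinable.ex (IsHDefinable.mem _ _)) (IsHDefinable.imp
          (IsHDefinable.all ((IsHDefinable.mem _ _).imp (IsHDefinable.ex
            ((IsHDefinable.mem _ _).and ((IsHDefinable.mem _ _).and (IsHDefinable.mem _ _))))))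
          (IsHDefinable.all ((IsHDefinable.mem _ _).imp (IsHDefinable.ex (IsHDefinable.ex
            (IsHDefinable.ex ((IsHDefinable.mem _ _).and ((IsHDefinable.pair _ _ _).and
              ((IsHDefinable.mem _ _).and (IsHDefinable.triple _ _ _ _)))))))))))))
  have hsub := hN.subset_hereditarySets
  have hωH := hsub hω
  let v : Fin 4 → hereditarySets lam := ![⟨_, hωH⟩, ⟨_, hsub hE⟩, ⟨_, hsub hS⟩, ⟨_, hsub hW⟩]
  have hv : ∀ i, (v i : ZFSet.{u}) ∈ N := by
    simpa [Fin.forall_fin_succ, v] using ⟨hω, hE, hS, hW⟩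
  have hord : ∀ a : Omega1.{u}, a.1.toZFSet ∈ hereditarySets lam := fun a =>
    hereditarySets_of_mem hωH (toZFSet_mem_zfSet a)
  let c : ZFSet.{u} := ZFSet.sep (fun x => ∃ γ ∈ C, γ.1.toZFSet = x) zfSet
  have hc : ∀ γ : Omega1.{u}, γ.1.toZFSet ∈ c ↔ γ ∈ C := by
    intro γ
    rw [ZFSet.mem_sep]
    constructor
    · rintro ⟨-, γ', h', he⟩
      rwa [← toZFSet_inj.1 he]
    · exact fun h' => ⟨toZFSet_mem_zfSet γ, γ, h', rfl⟩
  have hcH : c ∈ hereditarySets lam :=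
    subset_zfSet_mem_hereditarySets hlam ZFSet.sep_subset
  have hQc : Q v ⟨c, hcH⟩ := by
    constructor
    · intro b hb
      obtain ⟨β, hβ⟩ := mem_zfSet_iff.1 hb
      obtain ⟨β', hβ'⟩ := exists_gt β
      obtain ⟨γ, hγ, hγ'⟩ := hC β'
      refine ⟨⟨_, hord γ⟩, (hc γ).2 hγ, toZFSet_mem_zfSet γ, ?_⟩
      rw [← hβ]
      exact Ordinal.toZFSet_mem_toZFSet_iff.2 (hβ'.trans_le hγ')
    · rintro ⟨a, haH⟩ ha hne hlim ⟨i, hiH⟩ hi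
      obtain ⟨α, rfl⟩ := mem_zfSet_iff.1 ha
      obtain ⟨ι, rfl⟩ := mem_zfSet_iff.1 hi
      have hα : ∃ a, a < α := by
        obtain ⟨b, hb⟩ := hne
        obtain ⟨β, hβ, -⟩ := Ordinal.mem_toZFSet_iff.1 hb
        exact ⟨⟨β, hβ.trans α.2⟩, hβ⟩
      obtain ⟨j, hj, hWj⟩ := h α hα (fun β hβ => by
        obtain ⟨g, hg, hg₁, hg₂⟩ := hlim ⟨_, hord β⟩ (Ordinal.toZFSet_mem_toZFSet_iff.2 hβ)
        have hg₀ : g.1 ∈ c := hg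
        obtain ⟨-, γ, hγ, hγg⟩ := ZFSet.mem_sep.1 hg₀
        rw [← hγg] at hg₁ hg₂
        exact ⟨γ, hγ, Ordinal.toZFSet_mem_toZFSet_iff.1 hg₁,
          Ordinal.toZFSet_mem_toZFSet_iff.1 hg₂⟩) ι
      have ht : ZFSet.pair α.1.toZFSet (ZFSet.pair ι.1.toZFSet j.1.toZFSet) ∈ relSet W :=
        triple_mem_relSet.2 ⟨j, rfl, hWj⟩
      exact ⟨⟨_, hord j⟩, ⟨_, hereditarySets_of_mem (hsub hE) hj⟩,
        ⟨_, hereditarySets_of_mem (hsub hW) ht⟩, hj, rfl, ht, rfl⟩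
  obtain ⟨d, hdN, hd₁, hd₂⟩ := IsHDefinable.exists_mem hN hQ v hv ⟨_, hQc⟩
  intro i
  obtain ⟨⟨j, hjH⟩, ⟨e, heH⟩, ⟨t, htH⟩, heE, he, htW, ht⟩ :=
    hd₂ ⟨_, hord δ⟩ (toZFSet_mem_zfSet δ) (by
      obtain ⟨a, ha⟩ := hδ₀
      exact ⟨⟨_, hord a⟩, Ordinal.toZFSet_mem_toZFSet_iff.2 ha⟩) (by
      -- `N ∩ ω₁` is a limit point of `d`: unboundedness of `d` is witnessed inside `N`.
      rintro ⟨b, hbH⟩ hb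
      obtain ⟨β, hβ, rfl⟩ := Ordinal.mem_toZFSet_iff.1 hb
      have hβN := (hδ ⟨β, hβ.trans δ.2⟩).2 hβ
      obtain ⟨g, hgN, hg₁, hg₂, hg₃⟩ := IsHDefinable.exists_mem hN (n := 3)
        (Q := fun v s => s.1 ∈ (v 0).1 ∧ s.1 ∈ (v 1).1 ∧ (v 2).1 ∈ s.1)
        ((IsHDefinable.mem _ _).and ((IsHDefinable.mem _ _).and (IsHDefinable.mem _ _)))
        ![d, ⟨_, hωH⟩, ⟨_, hbH⟩] (by
          simpa [Fin.forall_fin_succ] using ⟨hdN, hω, hβN⟩)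
        (hd₁ ⟨_, hbH⟩ (toZFSet_mem_zfSet ⟨β, hβ.trans δ.2⟩))
      obtain ⟨γ, hγ⟩ := mem_zfSet_iff.1 hg₂
      refine ⟨g, hg₁, hg₃, ?_⟩
      rw [← hγ] at hgN ⊢
      exact Ordinal.toZFSet_mem_toZFSet_iff.2 ((hδ γ).1 hgN)) ⟨_, hord i⟩ (toZFSet_mem_zfSet i)
  have ht' : ZFSet.pair δ.1.toZFSet (ZFSet.pair i.1.toZFSet j) ∈ relSet W := by
    have h' : t = ZFSet.pair δ.1.toZFSet (ZFSet.pair i.1.toZFSet j) := ht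
    rw [← h']
    exact htW
  obtain ⟨j', rfl, hj'⟩ := triple_mem_relSet.1 ht'
  refine ⟨j', ?_, hj'⟩
  have h' : e = ZFSet.pair j'.1.toZFSet S := he
  rw [← h']
  exact heE

end Omega1

/-! ### Coding a partial order of size `ℵ₁` as a set -/

section CodedPoset

variable {X : Type (u + 1)} (e : X ≃ Omega1.{u}) (S : ZFSet.{u})

/-- The set coding `x : X`: the index of `x` in `ω₁`, paired with a fixed set `S`. Since every
condition carries `S`, any elementary substructure containing the poset contains `S`. -/
noncomputable def conditionCode (x : X) : ZFSet.{u} := ZFSet.pair (e x).1.toZFSet S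

theorem conditionCode_injective : Function.Injective (conditionCode e S) := fun _ _ h =>
  e.injective (Omega1.toZFSet_inj.1 (ZFSet.pair_inj.1 h).1)

variable [Small.{u} X] [PartialOrder X]

/-- A partial order of size `ℵ₁`, transferred to the codes of its elements. -/
noncomputable def codedPoset : SetPoset.{u} where
  carrier := ZFSet.range (conditionCode e S)
  rel := ZFSet.range fun t : {t : X × X // t.1 ≤ t.2} =>
    ZFSet.pair (conditionCode e S t.1.1) (conditionCode e S t.1.2)
  rel_subset := by
    intro z hz
    obtain ⟨t, rfl⟩ := ZFSet.mem_range.1 hz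
    exact ZFSet.pair_mem_prod.2 ⟨ZFSet.mem_range_self _, ZFSet.mem_range_self _⟩
  refl := by
    intro p hp
    obtain ⟨x, rfl⟩ := ZFSet.mem_range.1 hp
    exact ZFSet.mem_range.2 ⟨⟨(x, x), le_rfl⟩, rfl⟩
  trans := by
    intro p q r hpq hqr
    obtain ⟨⟨⟨x, y⟩, hxy⟩, h⟩ := ZFSet.mem_range.1 hpq
    obtain ⟨⟨⟨y', z⟩, hyz⟩, h'⟩ := ZFSet.mem_range.1 hqr
    obtain ⟨rfl, rfl⟩ := ZFSet.pair_inj.1 h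
    obtain ⟨h₁, rfl⟩ := ZFSet.pair_inj.1 h'
    obtain rfl := conditionCode_injective e S h₁
    exact ZFSet.mem_range.2 ⟨⟨(x, z), le_trans hxy hyz⟩, rfl⟩
  antisymm := by
    intro p q hpq hqp
    obtain ⟨⟨⟨x, y⟩, hxy⟩, h⟩ := ZFSet.mem_range.1 hpq
    obtain ⟨⟨⟨y', x'⟩, hyx⟩, h'⟩ := ZFSet.mem_range.1 hqp
    obtain ⟨rfl, rfl⟩ := ZFSet.pair_inj.1 h
    obtain ⟨h₁, h₂⟩ := ZFSet.pair_inj.1 h'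
    obtain rfl := conditionCode_injective e S h₁
    obtain rfl := conditionCode_injective e S h₂
    exact congrArg _ (le_antisymm hxy hyx)

namespace codedPoset

theorem mem_carrier {z : ZFSet.{u}} :
    z ∈ (codedPoset e S).carrier ↔ ∃ x, conditionCode e S x = z := ZFSet.mem_range

theorem extends_iff {z w : ZFSet.{u}} : (codedPoset e S).Extends z w ↔
    ∃ x y : X, x ≤ y ∧ conditionCode e S x = z ∧ conditionCode e S y = w := by
  refine ZFSet.mem_range.trans ⟨?_, ?_⟩
  · rintro ⟨⟨⟨x, y⟩, hxy⟩, h⟩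
    exact ⟨x, y, hxy, ZFSet.pair_inj.1 h⟩
  · rintro ⟨x, y, hxy, rfl, rfl⟩
    exact ⟨⟨⟨x, y⟩, hxy⟩, rfl⟩

theorem extends_code_iff {x y : X} :
    (codedPoset e S).Extends (conditionCode e S x) (conditionCode e S y) ↔ x ≤ y := by
  rw [extends_iff]
  constructor
  · rintro ⟨x', y', h, hx, hy⟩
    rwa [← conditionCode_injective e S hx, ← conditionCode_injective e S hy]
  · exact fun h => ⟨x, y, h, rfl, rfl⟩

theorem card_carrier : (codedPoset e S).carrier.card = ℵ_ 1 := by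
  rw [← Cardinal.lift_inj.{u, u + 1}, ← ZFSet.cardinalMk_coe_sort, ← Omega1.mk_eq]
  have h : ((codedPoset e S).carrier : Set ZFSet.{u}) = Set.range (conditionCode e S) :=
    ZFSet.coe_range _
  have h' : #(codedPoset e S).carrier = #(Set.range (conditionCode e S)) := by
    rw [← h]; rfl
  rw [h', Cardinal.mk_range_eq _ (conditionCode_injective e S), Cardinal.mk_congr e]

theorem exists_code_mem_of_isDense {E : ZFSet.{u}} (hE : (codedPoset e S).IsDense E) (x : X) :
    ∃ y ≤ x, conditionCode e S y ∈ E := by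
  obtain ⟨z, hz, hzx⟩ := hE.2 _ ((mem_carrier e S).2 ⟨x, rfl⟩)
  obtain ⟨y, rfl⟩ := (mem_carrier e S).1 (hE.1 hz)
  exact ⟨y, (extends_code_iff e S).1 hzx, hz⟩

end codedPoset

end CodedPoset

/-- The consequence of `PFA*(ω₁)` for a partial order `X` enumerated in type `ω₁` by `e`, with
finite properness replaced by combinatorial conditions that do not mention elementary substructures.
Here `good α x` says that `x` is prepared for a model of height `α`, and `closed α` that
`α` is closed under the operations relevant to `X`. -/
theorem PFAStar.exists_generic (hPFA : PFAStar.{u}) {X : Type (u + 1)} [PartialOrder X] [Nonempty X]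
    (e : X ≃ Omega1.{u}) (good : Omega1.{u} → X → Prop) (closed : Omega1.{u} → Prop)
    (good_mono : ∀ α x y, x ≤ y → good α y → good α x)
    (exists_good : ∀ F : Set Omega1.{u}, F.Finite → (∀ α ∈ F, closed α) →
      ∀ x : X, (∀ α ∈ F, e x < α) → ∃ y ≤ x, ∀ α ∈ F, good α y)
    (predense : ∀ D : Set X, (∀ x, ∃ y ∈ D, y ≤ x) → ∃ C : Set Omega1.{u}, IsCofinal C ∧
      ∀ α, (∃ a, a < α) → (∀ β < α, ∃ γ ∈ C, β < γ ∧ γ < α) → closed α ∧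
        ∀ x, good α x → ∃ y ∈ D, e y < α ∧ ∃ z, z ≤ x ∧ z ≤ y)
    (D : Omega1.{u} → Set X) (hD : ∀ i x, ∃ y ∈ D i, y ≤ x) :
    ∃ G : Set X, (∀ x ∈ G, ∀ y ∈ G, ∃ z ∈ G, z ≤ x ∧ z ≤ y) ∧ ∀ i, ∃ x ∈ G, x ∈ D i := by
  classical
  have : Small.{u} X := small_map e
  obtain ⟨T₁, T₂, hT⟩ := Omega1.exists_generating_operations.{u}
  let W : Omega1.{u} → Omega1.{u} → Omega1.{u} → Prop := fun α i j => closed α ∧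
    (good α (e.symm i) → e (e.symm j) < α ∧ ∃ z, z ≤ e.symm i ∧ z ≤ e.symm j)
  let S : ZFSet.{u} := Omega1.paramSet (fun a b c => T₁ a b = c) (fun a b c => T₂ a b = c) W
  let P : SetPoset.{u} := codedPoset e S
  have hPmem : ∀ {z}, z ∈ P.carrier ↔ ∃ x, conditionCode e S x = z := codedPoset.mem_carrier e S
  have hPext : ∀ {x y}, P.Extends (conditionCode e S x) (conditionCode e S y) ↔ x ≤ y :=
    codedPoset.extends_code_iff e S
  have hproper : P.FinitelyProper := by
    intro lam _ hlam F hF hFN p hp hpF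
    have hlam' : ℵ_ 1 < lam := lt_of_lt_of_le (Cardinal.aleph_lt_aleph.2 one_lt_two) hlam
    have key : ∀ N ∈ F, ∃ δ : Omega1.{u}, closed δ ∧
        (∀ a : Omega1.{u}, a.1.toZFSet ∈ N ↔ a < δ) ∧
        ∀ E ∈ N, P.IsDense E → ∀ x, good δ x →
          ∃ y, conditionCode e S y ∈ E ∧ conditionCode e S y ∈ N ∧ ∃ z, z ≤ x ∧ z ≤ y := by
      intro N hNF
      obtain ⟨hN, hPN⟩ := hFN N hNF
      have hcN : P.carrier ∈ N := (hN.mem_of_pair_mem hPN).1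
      have hSN : S ∈ N := by
        obtain ⟨w, hw, hw'⟩ := hN.exists_mem_of_nonempty hcN hp
        obtain ⟨x, rfl⟩ := hPmem.1 hw'
        exact (hN.mem_of_pair_mem hw).2
      obtain ⟨hω, h2⟩ := hN.mem_of_pair_mem hSN
      obtain ⟨hT₁, h3⟩ := hN.mem_of_pair_mem h2
      obtain ⟨hT₂, hW⟩ := hN.mem_of_pair_mem h3
      obtain ⟨δ, hδ₀, hδ⟩ := Omega1.exists_height hN hT hω hT₁ hT₂
      have hrefl : ∀ E ∈ N, P.IsDense E → ∀ i, ∃ j : Omega1.{u},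
          ZFSet.pair j.1.toZFSet S ∈ E ∧ W δ i j := by
        intro E hEN hE
        obtain ⟨C, hC, hCα⟩ := predense {x | conditionCode e S x ∈ E} fun x => by
          obtain ⟨y, hyx, hy⟩ := codedPoset.exists_code_mem_of_isDense e S hE x
          exact ⟨y, hy, hyx⟩
        refine Omega1.reflection hlam' hN hω hW hEN hSN hδ₀ hδ hC fun α hα hlim i => ?_
        obtain ⟨hcl, hg⟩ := hCα α hα hlim
        by_cases hgi : good α (e.symm i)
        · obtain ⟨y, hy, hyα, hyz⟩ := hg _ hgi
          exact ⟨e y, hy, hcl, fun _ => by simpa using ⟨hyα, hyz⟩⟩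
        · obtain ⟨x⟩ := ‹Nonempty X›
          obtain ⟨y, -, hy⟩ := codedPoset.exists_code_mem_of_isDense e S hE x
          exact ⟨e y, hy, hcl, fun h => absurd h hgi⟩
      have hdense : P.IsDense P.carrier := ⟨fun _ h => h, fun q hq => ⟨q, hq, P.refl q hq⟩⟩
      refine ⟨δ, ?_, hδ, fun E hEN hE x hx => ?_⟩
      · obtain ⟨j, -, hj⟩ := hrefl _ hcN hdense δ
        exact hj.1
      · obtain ⟨j, hjE, -, hj⟩ := hrefl E hEN hE (e x)
        rw [e.symm_apply_apply] at hj
        obtain ⟨hjδ, hz⟩ := hj hx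
        have hcode : conditionCode e S (e.symm j) = ZFSet.pair j.1.toZFSet S := by
          rw [conditionCode, e.apply_symm_apply]
        rw [e.apply_symm_apply] at hjδ
        refine ⟨e.symm j, ?_, ?_, hz⟩
        · rwa [hcode]
        · rw [hcode]
          exact hN.pair_mem ((hδ j).2 hjδ) hSN
            (hereditarySets_of_mem (hN.subset_hereditarySets hEN) hjE)
    have : Nonempty Omega1.{u} := ‹Nonempty X›.map e
    choose! h hclosed hh hgen using key
    obtain ⟨x, rfl⟩ := hPmem.1 hp
    obtain ⟨y, hyx, hy⟩ := exists_good (h '' F) (hF.image h)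
      (by rintro _ ⟨N, hN, rfl⟩; exact hclosed N hN) x (by
        rintro _ ⟨N, hN, rfl⟩
        exact (hh N hN _).1 ((hFN N hN).1.mem_of_pair_mem (hpF N hN)).1)
    refine ⟨conditionCode e S y, hPext.2 hyx, fun N hN E hEN hE q hq => ?_⟩
    obtain ⟨q', y', hqy, rfl, hy'⟩ := (codedPoset.extends_iff e S).1 hq
    obtain rfl := conditionCode_injective e S hy'
    obtain ⟨w, hwE, hwN, z, hz⟩ :=
      hgen N hN E hEN hE q' (good_mono _ _ _ hqy (hy _ ⟨N, hN, rfl⟩))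
    exact ⟨_, hwE, hwN, conditionCode e S z, hPext.2 hz.1, hPext.2 hz.2⟩
  obtain ⟨G, hG, hGD⟩ := hPFA P ⟨hproper, codedPoset.card_carrier e S⟩
    (fun i => ZFSet.sep (fun z => ∃ x ∈ D i, conditionCode e S x = z) P.carrier) (by
      refine fun i => ⟨ZFSet.sep_subset, fun p hp => ?_⟩
      obtain ⟨x, rfl⟩ := hPmem.1 hp
      obtain ⟨y, hy, hyx⟩ := hD i x
      exact ⟨conditionCode e S y, ZFSet.mem_sep.2 ⟨hPmem.2 ⟨y, rfl⟩, y, hy, rfl⟩, hPext.2 hyx⟩)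
  refine ⟨{x | conditionCode e S x ∈ G}, fun x hx y hy => ?_, fun i => ?_⟩
  · obtain ⟨r, hr, hrx, hry⟩ := hG.2.2.2 (conditionCode e S x) hx (conditionCode e S y) hy
    obtain ⟨z, rfl⟩ := hPmem.1 (hG.1 hr)
    exact ⟨z, hr, hPext.1 hrx, hPext.1 hry⟩
  · obtain ⟨p, hp, hpi⟩ := hGD i
    obtain ⟨-, x, hx, rfl⟩ := ZFSet.mem_sep.1 hpi
    exact ⟨x, hp, hx⟩

/-! ### Ladders -/

theorem countable_setOf_finset_subset {α : Type*} {s : Set α} (hs : s.Countable) :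
    {t : Finset α | (t : Set α) ⊆ s}.Countable := by
  refine Set.MapsTo.countable_of_injOn (f := fun t : Finset α => (t : Set α)) ?_
    Finset.coe_injective.injOn (Set.countable_ofPred_finite_subset hs)
  exact fun t ht => ⟨t.finite_toSet, ht⟩


theorem Order.IsSuccLimit.exists_forall_lt_of_finite {α : Type*} [LinearOrder α] {δ : α}
    (hδ : Order.IsSuccLimit δ) {s : Set α} (hs : s.Finite) (hlt : ∀ x ∈ s, x < δ) :
    ∃ β < δ, ∀ x ∈ s, x < β := by
  induction s, hs using Set.Finite.induction_on with
  | empty =>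
    obtain ⟨b, hb⟩ := not_isMin_iff.1 hδ.not_isMin
    exact ⟨b, hb, fun x hx => absurd hx (Set.notMem_empty x)⟩
  | @insert a s _ _ ih =>
    obtain ⟨β, hβ, h⟩ := ih fun x hx => hlt x (Set.mem_insert_of_mem a hx)
    obtain ⟨c, hc, hcδ⟩ := hδ.isSuccPrelimit.lt_iff_exists_lt.1
      (max_lt hβ (hlt a (Set.mem_insert a s)))
    refine ⟨c, hc, ?_⟩
    rintro x (rfl | hx)
    · exact (le_max_right _ _).trans_lt hcδ
    · exact (h x hx).trans ((le_max_left _ _).trans_lt hcδ)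

theorem IsLadderSystem.finite_inter_Iio {A : Omega1.{u} → Set Omega1.{u}} (hA : IsLadderSystem A)
    {δ β : Omega1.{u}} (hδ : Order.IsSuccLimit δ) (hβ : β < δ) : (A δ ∩ Set.Iio β).Finite := by
  obtain ⟨-, hcof, htype⟩ := hA δ hδ
  obtain ⟨α, hα, hβα⟩ := hcof β hβ
  let a : A δ := ⟨α, hα⟩
  have h1 : Ordinal.typein (α := A δ) (· < ·) a < ω := by
    rw [← htype]
    exact Ordinal.typein_lt_type _ _
  have h2 : #{y : A δ // y < a} < ℵ₀ := by
    have := Ordinal.card_typein (r := ((· < ·) : A δ → A δ → Prop)) a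
    rw [← Ordinal.card_lt_aleph0] at h1
    exact this ▸ h1
  have h3 : Finite {y : A δ // y < a} := Cardinal.lt_aleph0_iff_finite.1 h2
  have h4 : (Set.range fun y : {y : A δ // y < a} => y.1.1).Finite := Set.finite_range _
  exact h4.subset fun y hy => ⟨⟨⟨y, hy.1⟩, (lt_of_lt_of_le hy.2 hβα : y < α)⟩, rfl⟩

/-! ### The forcing -/

/-- Finite approximations to a pair of clubs coding `B` along the ladder system `A`. -/
@[ext]
structure CodingCondition (A : Omega1.{u} → Set Omega1.{u}) (B : Set Omega1.{u}) where
  /-- The ordinals promised to belong to the first club. -/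
  pts : Finset Omega1.{u}
  /-- A pair `(a, b)` is the promise that the first club is disjoint from the interval `(a, b]`. -/
  gaps : Finset (Omega1.{u} × Omega1.{u})
  /-- The limit ordinals `δ` for which the intersection of `A δ` with the first club is decided to
  be its intersection with `pts`. -/
  decided : Finset Omega1.{u}
  /-- The least ordinal is promised to the club, so that every later ordinal missing from `pts` can
  be put into a gap. -/
  exists_le : ∀ y, ∃ x ∈ pts, x ≤ y
  notMem_gap : ∀ x ∈ pts, ∀ g ∈ gaps, g.1 < x → ¬ x ≤ g.2
  isSuccLimit : ∀ δ ∈ decided, Order.IsSuccLimit δ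
  parity : ∀ δ ∈ decided, δ ∈ B ↔ Odd (A δ ∩ pts).ncard

namespace CodingCondition

variable {A : Omega1.{u} → Set Omega1.{u}} {B : Set Omega1.{u}}

instance : PartialOrder (CodingCondition A B) where
  le q p := p.pts ⊆ q.pts ∧ p.gaps ⊆ q.gaps ∧ p.decided ⊆ q.decided ∧
    ∀ δ ∈ p.decided, ∀ x ∈ A δ, x ∈ q.pts → x ∈ p.pts
  le_refl p := ⟨subset_rfl, subset_rfl, subset_rfl, fun _ _ _ _ h => h⟩
  le_trans r q p hrq hqp := ⟨hqp.1.trans hrq.1, hqp.2.1.trans hrq.2.1, hqp.2.2.1.trans hrq.2.2.1,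
    fun δ hδ x hx hxr => hqp.2.2.2 δ hδ x hx (hrq.2.2.2 δ (hqp.2.2.1 hδ) x hx hxr)⟩
  le_antisymm p q hpq hqp := CodingCondition.ext (hqp.1.antisymm hpq.1)
    (hqp.2.1.antisymm hpq.2.1) (hqp.2.2.1.antisymm hpq.2.2.1)

theorem le_def {p q : CodingCondition A B} : q ≤ p ↔ p.pts ⊆ q.pts ∧ p.gaps ⊆ q.gaps ∧
    p.decided ⊆ q.decided ∧ ∀ δ ∈ p.decided, ∀ x ∈ A δ, x ∈ q.pts → x ∈ p.pts := Iff.rfl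

/-- All ordinals occurring in `p` are less than `α`. -/
def Below (p : CodingCondition A B) (α : Omega1.{u}) : Prop :=
  (∀ x ∈ p.pts, x < α) ∧ (∀ g ∈ p.gaps, g.1 < α ∧ g.2 < α) ∧ ∀ δ ∈ p.decided, δ < α

/-- The finitely many ordinals occurring in a condition. -/
def ordinals (p : CodingCondition A B) : Set Omega1.{u} :=
  ↑p.pts ∪ (Prod.fst '' (p.gaps : Set (Omega1.{u} × Omega1.{u})) ∪
    Prod.snd '' (p.gaps : Set (Omega1.{u} × Omega1.{u}))) ∪ ↑p.decided

theorem finite_ordinals (p : CodingCondition A B) : p.ordinals.Finite :=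
  (p.pts.finite_toSet.union ((p.gaps.finite_toSet.image _).union
    (p.gaps.finite_toSet.image _))).union p.decided.finite_toSet

theorem below_iff {p : CodingCondition A B} {α : Omega1.{u}} :
    p.Below α ↔ ∀ x ∈ p.ordinals, x < α := by
  constructor
  · rintro ⟨h1, h2, h3⟩ x ((hx | ⟨g, hg, rfl⟩ | ⟨g, hg, rfl⟩) | hx)
    exacts [h1 x hx, (h2 g hg).1, (h2 g hg).2, h3 x hx]
  · exact fun h => ⟨fun x hx => h x (Or.inl (Or.inl hx)),
      fun g hg => ⟨h _ (Or.inl (Or.inr (Or.inl ⟨g, hg, rfl⟩))),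
        h _ (Or.inl (Or.inr (Or.inr ⟨g, hg, rfl⟩)))⟩, fun x hx => h x (Or.inr hx)⟩

theorem Below.mono {p : CodingCondition A B} {α β : Omega1.{u}} (h : p.Below α) (hαβ : α ≤ β) :
    p.Below β := below_iff.2 fun x hx => (below_iff.1 h x hx).trans_le hαβ

theorem exists_below (p : CodingCondition A B) : ∃ α, p.Below α := by
  obtain ⟨α, hα⟩ := Omega1.exists_forall_lt p.finite_ordinals.countable
  exact ⟨α, below_iff.2 hα⟩

theorem Below.exists_lt {p : CodingCondition A B} {α : Omega1.{u}} (hα : Order.IsSuccLimit α)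
    (h : p.Below α) : ∃ β < α, p.Below β := by
  obtain ⟨β, hβ, h'⟩ := hα.exists_forall_lt_of_finite p.finite_ordinals (below_iff.1 h)
  exact ⟨β, hβ, below_iff.2 h'⟩

theorem countable_below (α : Omega1.{u}) : {p : CodingCondition A B | p.Below α}.Countable := by
  have hI := Omega1.countable_Iio α
  have h1 := countable_setOf_finset_subset hI
  have h2 := countable_setOf_finset_subset (hI.prod hI)
  refine ((h1.prod (h2.prod h1)).preimage_of_injOn
    (f := fun p : CodingCondition A B => (p.pts, p.gaps, p.decided)) ?_).mono ?_
  · intro p _ q _ h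
    simp only [Prod.mk.injEq] at h
    exact CodingCondition.ext h.1 h.2.1 h.2.2
  · exact fun p hp => ⟨fun x hx => hp.1 x hx, fun g hg => hp.2.1 g hg, fun x hx => hp.2.2 x hx⟩

/-- The condition that decides only that the least ordinal belongs to the club. The pair `(a, a)`
is a vacuous gap. -/
noncomputable def initial (A : Omega1.{u} → Set Omega1.{u}) (B : Set Omega1.{u}) (z : Omega1.{u})
    (hz : ∀ y, z ≤ y) (a : Omega1.{u}) : CodingCondition A B where
  pts := {z}
  gaps := {(a, a)}
  decided := ∅
  exists_le y := ⟨z, Finset.mem_singleton_self z, hz y⟩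
  notMem_gap x _ g hg h h' := by
    rw [Finset.mem_singleton] at hg
    subst hg
    exact absurd h h'.not_gt
  isSuccLimit δ hδ := absurd hδ (Finset.notMem_empty δ)
  parity δ hδ := absurd hδ (Finset.notMem_empty δ)

theorem nonempty_equiv (A : Omega1.{u} → Set Omega1.{u}) (B : Set Omega1.{u}) :
    Nonempty (CodingCondition A B ≃ Omega1.{u}) := by
  have hinf : Infinite Omega1.{u} := Set.infinite_univ_iff.1 fun h =>
    Omega1.not_countable h.countable
  obtain ⟨z, -, hz⟩ := WellFounded.has_min (α := Omega1.{u}) wellFounded_lt Set.univ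
    Set.univ_nonempty
  rw [← Cardinal.eq]
  apply le_antisymm
  · have hinj : Function.Injective
        fun p : CodingCondition A B => (p.pts, p.gaps, p.decided) := by
      intro p q h
      simp only [Prod.mk.injEq] at h
      exact CodingCondition.ext h.1 h.2.1 h.2.2
    refine (Cardinal.mk_le_of_injective hinj).trans ?_
    have h0 : ℵ₀ ≤ #Omega1.{u} := Cardinal.aleph0_le_mk _
    simp only [Cardinal.mk_prod, Cardinal.lift_id, Cardinal.mk_finset_of_infinite,
      Cardinal.mul_eq_self h0, le_refl]
  · refine Cardinal.mk_le_of_injective (f := initial A B z fun y => not_lt.1 (hz y trivial)) ?_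
    intro a b h
    have := congrArg CodingCondition.gaps h
    simpa [initial] using this

/-- Promise finitely many new points to the club. -/
noncomputable def addPts (p : CodingCondition A B) (s : Finset Omega1.{u})
    (hgap : ∀ x ∈ s, ∀ g ∈ p.gaps, g.1 < x → ¬ x ≤ g.2)
    (hdec : ∀ δ ∈ p.decided, ∀ x ∈ s, x ∉ A δ) : CodingCondition A B where
  pts := p.pts ∪ s
  gaps := p.gaps
  decided := p.decided
  exists_le y := by
    obtain ⟨x, hx, h⟩ := p.exists_le y
    exact ⟨x, Finset.mem_union_left _ hx, h⟩
  notMem_gap x hx := (Finset.mem_union.1 hx).elim (p.notMem_gap x) (hgap x)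
  isSuccLimit := p.isSuccLimit
  parity δ hδ := by
    have : A δ ∩ ↑(p.pts ∪ s) = A δ ∩ ↑p.pts := by
      ext x
      have := hdec δ hδ x
      simp only [Finset.coe_union, Set.mem_inter_iff, Set.mem_union, Finset.mem_coe]
      tauto
    rw [this]
    exact p.parity δ hδ

theorem addPts_le (p : CodingCondition A B) (s : Finset Omega1.{u}) (hgap) (hdec) :
    p.addPts s hgap hdec ≤ p :=
  ⟨Finset.subset_union_left, subset_rfl, subset_rfl, fun δ hδ x hx hxs =>
    (Finset.mem_union.1 hxs).elim id fun h => absurd hx (hdec δ hδ x h)⟩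

/-- Decide the intersection of the club with `A δ`, when it has the required parity. -/
noncomputable def addDecided (p : CodingCondition A B) (δ : Omega1.{u})
    (hδ : Order.IsSuccLimit δ) (hB : δ ∈ B ↔ Odd (A δ ∩ p.pts).ncard) : CodingCondition A B where
  pts := p.pts
  gaps := p.gaps
  decided := insert δ p.decided
  exists_le := p.exists_le
  notMem_gap := p.notMem_gap
  isSuccLimit := Finset.forall_mem_insert _ _ _ |>.2 ⟨hδ, p.isSuccLimit⟩
  parity := Finset.forall_mem_insert _ _ _ |>.2 ⟨hB, p.parity⟩

theorem addDecided_le (p : CodingCondition A B) (δ : Omega1.{u}) (hδ) (hB) :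
    p.addDecided δ hδ hB ≤ p :=
  ⟨subset_rfl, subset_rfl, Finset.subset_insert _ _, fun _ _ _ _ h => h⟩

/-- Exclude the interval `(a, b]` from the club. -/
noncomputable def addGap (p : CodingCondition A B) (a b : Omega1.{u})
    (h : ∀ x ∈ p.pts, a < x → ¬ x ≤ b) : CodingCondition A B where
  pts := p.pts
  gaps := insert (a, b) p.gaps
  decided := p.decided
  exists_le := p.exists_le
  notMem_gap x hx := Finset.forall_mem_insert _ _ _ |>.2 ⟨h x hx, p.notMem_gap x hx⟩
  isSuccLimit := p.isSuccLimit
  parity := p.parity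

theorem addGap_le (p : CodingCondition A B) (a b : Omega1.{u}) (h) : p.addGap a b h ≤ p :=
  ⟨subset_rfl, Finset.subset_insert _ _, subset_rfl, fun _ _ _ _ h => h⟩

/-- The part of a condition that lives below `α`. -/
noncomputable def restrict (hA : IsLadderSystem A) (p : CodingCondition A B) (α : Omega1.{u})
    (hα : ∃ a, a < α) : CodingCondition A B where
  pts := {x ∈ p.pts | x < α}
  gaps := {g ∈ p.gaps | g.1 < α ∧ g.2 < α}
  decided := {δ ∈ p.decided | δ < α}
  exists_le y := by
    obtain ⟨a, ha⟩ := hα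
    obtain ⟨x, hx, h⟩ := p.exists_le (min a y)
    exact ⟨x, Finset.mem_filter.2 ⟨hx, (h.trans (min_le_left _ _)).trans_lt ha⟩,
      h.trans (min_le_right _ _)⟩
  notMem_gap x hx g hg := p.notMem_gap x (Finset.mem_filter.1 hx).1 g (Finset.mem_filter.1 hg).1
  isSuccLimit δ hδ := p.isSuccLimit δ (Finset.mem_filter.1 hδ).1
  parity δ hδ := by
    obtain ⟨hδ, hδα⟩ := Finset.mem_filter.1 hδ
    have : A δ ∩ ↑(p.pts.filter (· < α)) = A δ ∩ ↑p.pts := by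
      ext x
      have h := fun hx => ((hA δ (p.isSuccLimit δ hδ)).1 x hx).trans hδα
      simp only [Finset.coe_filter, Set.mem_inter_iff, Set.mem_ofPred_eq, Finset.mem_coe]
      tauto
    rw [this]
    exact p.parity δ hδ

theorem le_restrict (hA : IsLadderSystem A) (p : CodingCondition A B) (α : Omega1.{u})
    (hα : ∃ a, a < α) : p ≤ p.restrict hA α hα := by
  refine ⟨Finset.filter_subset _ _, Finset.filter_subset _ _, Finset.filter_subset _ _,
    fun δ hδ x hx hxp => ?_⟩
  obtain ⟨hδ, hδα⟩ := Finset.mem_filter.1 hδ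
  exact Finset.mem_filter.2 ⟨hxp, ((hA δ (p.isSuccLimit δ hδ)).1 x hx).trans hδα⟩

theorem restrict_below (hA : IsLadderSystem A) (p : CodingCondition A B) (α : Omega1.{u})
    (hα : ∃ a, a < α) : (p.restrict hA α hα).Below α :=
  ⟨fun _ hx => (Finset.mem_filter.1 hx).2, fun _ hg => (Finset.mem_filter.1 hg).2,
    fun _ hx => (Finset.mem_filter.1 hx).2⟩

/-- The amalgamation behind properness: once `α` is promised to the club by `q`, no gap of `q`
crosses `α`, and a condition below `α` that extends the restriction of `q` can only conflict with
`q` by having new points on ladders at or above `α`. -/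
theorem exists_le_of_le_restrict (hA : IsLadderSystem A) {q y : CodingCondition A B}
    {α : Omega1.{u}} {hα : ∃ a, a < α} (hαq : α ∈ q.pts) (hy : y ≤ q.restrict hA α hα)
    (hyα : y.Below α)
    (hnew : ∀ η ∈ q.decided, α ≤ η → ∀ x ∈ A η, x ∈ y.pts → x ∈ q.pts) :
    ∃ z, z ≤ q ∧ z ≤ y := by
  obtain ⟨hpts, hgaps, hdec, hprom⟩ := hy
  have mem_pts : ∀ {x}, x ∈ q.pts → x < α → x ∈ y.pts := fun hx hxα =>
    hpts (Finset.mem_filter.2 ⟨hx, hxα⟩)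
  -- The two promises agree with the union of the points.
  have hyq : ∀ δ ∈ y.decided, ∀ x ∈ A δ, x ∈ q.pts → x ∈ y.pts := fun δ hδ x hx hxq =>
    mem_pts hxq (((hA δ (y.isSuccLimit δ hδ)).1 x hx).trans (hyα.2.2 δ hδ))
  have hqy : ∀ δ ∈ q.decided, ∀ x ∈ A δ, x ∈ y.pts → x ∈ q.pts := by
    intro δ hδ x hx hxy
    rcases lt_or_ge δ α with h | h
    · exact (Finset.mem_filter.1 (hprom δ (Finset.mem_filter.2 ⟨hδ, h⟩) x hx hxy)).1
    · exact hnew δ hδ h x hx hxy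
  refine ⟨⟨q.pts ∪ y.pts, q.gaps ∪ y.gaps, q.decided ∪ y.decided, fun a => ?_, ?_, ?_, ?_⟩,
    ⟨Finset.subset_union_left, Finset.subset_union_left, Finset.subset_union_left, ?_⟩,
    ⟨Finset.subset_union_right, Finset.subset_union_right, Finset.subset_union_right, ?_⟩⟩
  · obtain ⟨x, hx, h⟩ := q.exists_le a
    exact ⟨x, Finset.mem_union_left _ hx, h⟩
  · intro x hx g hg h1 h2
    rcases Finset.mem_union.1 hx with hx | hx <;> rcases Finset.mem_union.1 hg with hg | hg
    · exact q.notMem_gap x hx g hg h1 h2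
    · exact y.notMem_gap x (mem_pts hx (h2.trans_lt (hyα.2.1 g hg).2)) g hg h1 h2
    · have hxα := hyα.1 x hx
      have hg1 : g.1 < α := h1.trans hxα
      have hg2 : g.2 < α := not_le.1 (q.notMem_gap α hαq g hg hg1)
      exact y.notMem_gap x hx g (hgaps (Finset.mem_filter.2 ⟨hg, hg1, hg2⟩)) h1 h2
    · exact y.notMem_gap x hx g hg h1 h2
  · intro δ hδ
    exact (Finset.mem_union.1 hδ).elim (q.isSuccLimit δ) (y.isSuccLimit δ)
  · intro δ hδ
    rcases Finset.mem_union.1 hδ with hδ | hδ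
    · have : A δ ∩ ↑(q.pts ∪ y.pts) = A δ ∩ ↑q.pts := by
        ext x
        have := hqy δ hδ x
        simp only [Finset.coe_union, Set.mem_inter_iff, Set.mem_union, Finset.mem_coe]
        tauto
      rw [this]
      exact q.parity δ hδ
    · have : A δ ∩ ↑(q.pts ∪ y.pts) = A δ ∩ ↑y.pts := by
        ext x
        have := hyq δ hδ x
        simp only [Finset.coe_union, Set.mem_inter_iff, Set.mem_union, Finset.mem_coe]
        tauto
      rw [this]
      exact y.parity δ hδ
  · exact fun δ hδ x hx h => (Finset.mem_union.1 h).elim id (hqy δ hδ x hx)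
  · exact fun δ hδ x hx h => (Finset.mem_union.1 h).elim (hyq δ hδ x hx) id

end CodingCondition

namespace CodingCondition

variable {A : Omega1.{u} → Set Omega1.{u}} {B : Set Omega1.{u}}

/-! ### Properness of the forcing -/

/-- For club many `α`, every condition that promises `α` to the club is compatible with a
condition below `α` from the given dense set. -/
theorem exists_club_predense (hA : IsLadderSystem A) (e : CodingCondition A B ≃ Omega1.{u})
    (D : Set (CodingCondition A B)) (hD : ∀ p, ∃ q ∈ D, q ≤ p) :
    ∃ C : Set Omega1.{u}, IsCofinal C ∧
      ∀ α, (∃ a, a < α) → (∀ β < α, ∃ γ ∈ C, β < γ ∧ γ < α) →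
        (∀ p, e p < α → p.Below α) ∧
        ∀ p, α ∈ p.pts → ∃ q ∈ D, e q < α ∧ ∃ r, r ≤ p ∧ r ≤ q := by
  have h1 : ∀ x, ∃ w, (e.symm x).Below w := fun x => exists_below _
  have h2 : ∀ x, ∃ w, ∀ p : CodingCondition A B, p.Below x → e p < w := by
    intro x
    obtain ⟨w, hw⟩ := Omega1.exists_forall_lt ((countable_below (A := A) (B := B) x).image e)
    exact ⟨w, fun p hp => hw _ ⟨p, hp, rfl⟩⟩
  -- Here `w` bounds the index of some extension in `D` with new points from `γ` on; if there is no
  -- such extension, then `w = γ` bounds the thresholds that can replace `γ`.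
  have h3 : ∀ x γ, ∃ w,
      (∃ q ∈ D, e q < w ∧ q ≤ e.symm x ∧ ∀ y ∈ q.pts, y ∉ (e.symm x).pts → γ ≤ y) ∨
      ¬ ∃ q ∈ D, q ≤ e.symm x ∧ ∀ y ∈ q.pts, y ∉ (e.symm x).pts → w ≤ y := by
    intro x γ
    by_cases h : ∃ q ∈ D, q ≤ e.symm x ∧ ∀ y ∈ q.pts, y ∉ (e.symm x).pts → γ ≤ y
    · obtain ⟨q, hq, h⟩ := h
      obtain ⟨w, hw⟩ := Omega1.exists_gt (e q)
      exact ⟨w, Or.inl ⟨q, hq, hw, h⟩⟩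
    · exact ⟨γ, Or.inr h⟩
  choose f₁ hf₁ using h1
  choose f₂ hf₂ using h2
  choose f₃ hf₃ using h3
  refine ⟨_, Omega1.isCofinal_closed fun x y => max (f₁ x) (max (f₂ x) (f₃ x y)), ?_⟩
  intro α hα hlim
  have hcl : ∀ x < α, ∃ μ < α, Order.IsSuccLimit μ ∧ x < μ ∧
      (∀ x < μ, f₁ x < μ) ∧ ∀ x < μ, ∀ y < μ, f₃ x y < μ := by
    intro x hx
    obtain ⟨μ, ⟨hμ, hμ'⟩, hxμ, hμα⟩ := hlim x hx
    exact ⟨μ, hμα, hμ, hxμ, fun x hx => (le_max_left _ _).trans_lt (hμ' x hx x hx),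
      fun x hx y hy => ((le_max_right _ _).trans (le_max_right _ _)).trans_lt (hμ' x hx y hy)⟩
  have hlimit : Order.IsSuccLimit α := by
    refine ⟨fun h => ?_, fun x hx => ?_⟩
    · obtain ⟨a, ha⟩ := hα
      exact (h ha.le).not_gt ha
    · obtain ⟨μ, hμα, -, hxμ, -⟩ := hcl x hx.lt
      exact hx.2 hxμ hμα
  have hbelow : ∀ {μ}, (∀ x < μ, f₁ x < μ) → ∀ p, e p < μ → p.Below μ := by
    intro μ hμ p hp
    have := hf₁ (e p)
    rw [e.symm_apply_apply] at this
    exact this.mono (hμ _ hp).le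
  refine ⟨fun p hp => ?_, fun p hαp => ?_⟩
  · obtain ⟨μ, hμα, -, hpμ, hμ₁, -⟩ := hcl _ hp
    exact (hbelow hμ₁ p hpμ).mono hμα.le
  -- Extend `p` into `D`, and look for `y ∈ D` below `α` that resembles `q`.
  obtain ⟨q, hqD, hqp⟩ := hD p
  have hαq : α ∈ q.pts := hqp.1 hαp
  let r := q.restrict hA α hα
  have hr : e r < α := by
    obtain ⟨β, hβα, hβ⟩ := (restrict_below hA q α hα).exists_lt hlimit
    obtain ⟨μ, ⟨hμ, hμ'⟩, hβμ, hμα⟩ := hlim β hβα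
    exact ((hf₂ β _ hβ).trans_le ((le_max_left _ _).trans (le_max_right _ _))).trans
      ((hμ' β hβμ β hβμ).trans hμα)
  obtain ⟨μ, hμα, hμ, hrμ, hμ₁, hμ₃⟩ := hcl _ hr
  -- The ladders at or above `α` have only finitely many points below `μ`.
  have hfin : (⋃ η ∈ {η | η ∈ q.decided ∧ α ≤ η}, A η ∩ Set.Iio μ).Finite := by
    refine Set.Finite.biUnion (q.decided.finite_toSet.subset fun η hη => hη.1) fun η hη => ?_
    exact hA.finite_inter_Iio (q.isSuccLimit η hη.1) (hμα.trans_le hη.2)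
  obtain ⟨γ, hγμ, hγ⟩ := hμ.exists_forall_lt_of_finite hfin (by
    intro x hx
    obtain ⟨η, -, hx⟩ := Set.mem_iUnion₂.1 hx
    exact hx.2)
  have hw := hμ₃ _ hrμ _ hγμ
  rcases hf₃ (e r) γ with ⟨y, hyD, hye, hyr, hynew⟩ | h
  · rw [e.symm_apply_apply] at hyr hynew
    have hyμ : y.Below μ := hbelow hμ₁ y (hye.trans hw)
    obtain ⟨z, hzq, hzy⟩ := exists_le_of_le_restrict hA hαq hyr (hyμ.mono hμα.le) (by
      intro η hη hαη x hx hxy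
      by_cases hxr : x ∈ r.pts
      · exact (Finset.mem_filter.1 hxr).1
      · exact absurd (hynew x hxy hxr)
          (hγ x (Set.mem_iUnion₂.2 ⟨η, ⟨hη, hαη⟩, hx, hyμ.1 x hxy⟩)).not_ge)
    exact ⟨y, hyD, (hye.trans hw).trans hμα, z, hzq.trans hqp, hzy⟩
  · refine absurd ⟨q, hqD, ?_, fun x hx hxr => ?_⟩ h
    · rw [e.symm_apply_apply]
      exact le_restrict hA q α hα
    · rw [e.symm_apply_apply] at hxr
      by_contra hxw
      exact hxr (Finset.mem_filter.2 ⟨hx, (not_le.1 hxw).trans (hw.trans hμα)⟩)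

theorem exists_le_subset_pts (hA : IsLadderSystem A) (p : CodingCondition A B)
    {s : Set Omega1.{u}} (hs : s.Finite) (h : ∀ α ∈ s, p.Below α) :
    ∃ q ≤ p, ∀ α ∈ s, α ∈ q.pts :=
  ⟨p.addPts hs.toFinset
    (fun x hx g hg _ hle => ((h x (hs.mem_toFinset.1 hx)).2.1 g hg).2.not_ge hle)
    (fun δ hδ x hx hxA => ((h x (hs.mem_toFinset.1 hx)).2.2 δ hδ).not_gt
      ((hA δ (p.isSuccLimit δ hδ)).1 x hxA)),
    addPts_le _ _ _ _, fun _ hα => Finset.mem_union_right _ (hs.mem_toFinset.2 hα)⟩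

/-! ### Density -/

theorem exists_limit_gt (hA : IsLadderSystem A) (p : CodingCondition A B) (γ : Omega1.{u}) :
    ∃ q ≤ p, ∃ ξ ∈ q.pts, γ ≤ ξ ∧ Order.IsSuccLimit ξ := by
  obtain ⟨b, hb⟩ := p.exists_below
  obtain ⟨ξ, ⟨hξ, -⟩, hbξ⟩ := Omega1.isCofinal_closed (fun x _ => x) (max b γ)
  obtain ⟨q, hq, h⟩ := p.exists_le_subset_pts hA (Set.finite_singleton ξ) (by
    rintro _ rfl
    exact hb.mono ((le_max_left _ _).trans hbξ))
  exact ⟨q, hq, ξ, h ξ rfl, (le_max_right _ _).trans hbξ, hξ⟩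

/-- If a limit `δ` is promised to the club, then its ladder can be decided with the parity
required by `B`: the parity is corrected, if necessary, by a new point of `A δ` close to `δ`. -/
theorem exists_decided (hA : IsLadderSystem A) (p : CodingCondition A B) {δ : Omega1.{u}}
    (hδp : δ ∈ p.pts) (hδ : Order.IsSuccLimit δ) : ∃ q ≤ p, δ ∈ q.decided := by
  by_cases hdec : δ ∈ p.decided
  · exact ⟨p, le_rfl, hdec⟩
  by_cases hpar : δ ∈ B ↔ Odd (A δ ∩ p.pts).ncard
  · exact ⟨p.addDecided δ hδ hpar, addDecided_le _ _ _ _, Finset.mem_insert_self _ _⟩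
  -- The finitely many obstacles below `δ` to adding a point.
  let U : Set Omega1.{u} := (p.ordinals ∪ ⋃ η ∈ {η | η ∈ p.decided ∧ δ < η}, A η) ∩ Set.Iio δ
  have hU : U.Finite := by
    refine Set.Finite.subset (p.finite_ordinals.union (Set.Finite.biUnion
      (t := fun η => A η ∩ Set.Iio δ)
      (p.decided.finite_toSet.subset fun η (hη : η ∈ {η | η ∈ p.decided ∧ δ < η}) => hη.1)
      fun η hη => hA.finite_inter_Iio (p.isSuccLimit η hη.1) hη.2)) ?_
    rintro x ⟨hx | hx, hxδ⟩
    · exact Or.inl hx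
    · obtain ⟨η, hη, hx⟩ := Set.mem_iUnion₂.1 hx
      exact Or.inr (Set.mem_iUnion₂.2 ⟨η, hη, hx, hxδ⟩)
  obtain ⟨β, hβ, hβU⟩ := hδ.exists_forall_lt_of_finite hU fun x hx => hx.2
  obtain ⟨x, hxA, hβx⟩ := (hA δ hδ).2.1 β hβ
  have hxδ : x < δ := (hA δ hδ).1 x hxA
  have hxU : ∀ y ∈ U, y < x := fun y hy => (hβU y hy).trans_le hβx
  have hxp : x ∉ p.pts := fun h => lt_irrefl x (hxU x ⟨Or.inl (Or.inl (Or.inl h)), hxδ⟩)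
  let q := p.addPts {x} (by
    intro y hy g hg h1 h2
    obtain rfl := Finset.mem_singleton.1 hy
    by_cases hgδ : g.2 < δ
    · exact (hxU g.2 ⟨Or.inl (Or.inl (Or.inr (Or.inr ⟨g, hg, rfl⟩))), hgδ⟩).not_ge h2
    · exact p.notMem_gap δ hδp g hg (h1.trans hxδ) (not_lt.1 hgδ)) (by
    intro η hη y hy hyη
    obtain rfl := Finset.mem_singleton.1 hy
    rcases lt_trichotomy η δ with h | rfl | h
    · exact ((hA η (p.isSuccLimit η hη)).1 y hyη).not_gt (hxU η ⟨Or.inl (Or.inr hη), h⟩)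
    · exact hdec hη
    · exact lt_irrefl y (hxU y ⟨Or.inr (Set.mem_iUnion₂.2 ⟨η, ⟨hη, h⟩, hyη⟩), hxδ⟩))
  have hcard : (A δ ∩ q.pts).ncard = (A δ ∩ p.pts).ncard + 1 := by
    have : A δ ∩ ↑(p.pts ∪ {x}) = insert x (A δ ∩ ↑p.pts) := by
      ext y
      simp only [Finset.coe_union, Finset.coe_singleton, Set.mem_inter_iff, Set.mem_union,
        Set.mem_singleton_iff, Set.mem_insert_iff]
      constructor
      · tauto
      · rintro (rfl | h)
        · exact ⟨hxA, Or.inr rfl⟩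
        · exact ⟨h.1, Or.inl h.2⟩
    change (A δ ∩ ↑(p.pts ∪ {x})).ncard = _
    rw [this, Set.ncard_insert_of_notMem (fun h => hxp h.2)
      (p.pts.finite_toSet.subset Set.inter_subset_right)]
  refine ⟨q.addDecided δ hδ ?_, (addDecided_le _ _ _ _).trans (addPts_le _ _ _ _),
    Finset.mem_insert_self _ _⟩
  rw [hcard, Nat.odd_add_one]
  exact (not_iff_comm.1 (not_iff.1 hpar)).symm

theorem exists_pts_or_gap (p : CodingCondition A B) (γ : Omega1.{u}) :
    ∃ q ≤ p, γ ∈ q.pts ∨ ∃ g ∈ q.gaps, g.1 < γ ∧ γ ≤ g.2 := by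
  by_cases hγ : γ ∈ p.pts
  · exact ⟨p, le_rfl, Or.inl hγ⟩
  have hne : (p.pts.filter (· < γ)).Nonempty := by
    obtain ⟨x, hx, hxγ⟩ := p.exists_le γ
    exact ⟨x, Finset.mem_filter.2 ⟨hx, lt_of_le_of_ne hxγ fun h => hγ (h ▸ hx)⟩⟩
  refine ⟨p.addGap ((p.pts.filter (· < γ)).max' hne) γ ?_, addGap_le _ _ _ _, Or.inr
    ⟨_, Finset.mem_insert_self _ _, (Finset.mem_filter.1 (Finset.max'_mem _ hne)).2, le_rfl⟩⟩
  intro x hx hlt hle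
  have hxγ : x < γ := lt_of_le_of_ne hle fun h => hγ (h ▸ hx)
  exact hlt.not_ge (Finset.le_max' _ _ (Finset.mem_filter.2 ⟨hx, hxγ⟩))

/-- The conditions that determine the two clubs at `γ`, and make them reach at least `γ`. -/
def Decides (p : CodingCondition A B) (γ : Omega1.{u}) : Prop :=
  (∃ ξ ∈ p.pts, γ ≤ ξ ∧ Order.IsSuccLimit ξ) ∧
    ((γ ∈ p.pts ∧ (Order.IsSuccLimit γ → γ ∈ p.decided)) ∨ ∃ g ∈ p.gaps, g.1 < γ ∧ γ ≤ g.2)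

theorem exists_decides (hA : IsLadderSystem A) (γ : Omega1.{u}) (p : CodingCondition A B) :
    ∃ q, q.Decides γ ∧ q ≤ p := by
  obtain ⟨q, hq, ξ, hξ, hγξ, hlim⟩ := p.exists_limit_gt hA γ
  obtain ⟨r, hr, hγ | ⟨g, hg, h⟩⟩ := q.exists_pts_or_gap γ
  · by_cases hγlim : Order.IsSuccLimit γ
    · obtain ⟨s, hs, hdec⟩ := r.exists_decided hA hγ hγlim
      exact ⟨s, ⟨⟨ξ, hs.1 (hr.1 hξ), hγξ, hlim⟩, Or.inl ⟨hs.1 hγ, fun _ => hdec⟩⟩,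
        hs.trans (hr.trans hq)⟩
    · exact ⟨r, ⟨⟨ξ, hr.1 hξ, hγξ, hlim⟩, Or.inl ⟨hγ, fun h => absurd h hγlim⟩⟩, hr.trans hq⟩
  · exact ⟨r, ⟨⟨ξ, hr.1 hξ, hγξ, hlim⟩, Or.inr ⟨g, hg, h⟩⟩, hr.trans hq⟩

/-! ### The clubs added by a generic filter -/

theorem exists_clubs_of_generic {G : Set (CodingCondition A B)}
    (hdir : ∀ p ∈ G, ∀ q ∈ G, ∃ r ∈ G, r ≤ p ∧ r ≤ q) (hG : ∀ γ, ∃ p ∈ G, p.Decides γ) :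
    ∃ C D : Set Omega1.{u}, IsClub C ∧ IsClub D ∧
      ∀ δ ∈ D, Order.IsSuccLimit δ ∧ (A δ ∩ C).Finite ∧
        (δ ∈ B → Odd (A δ ∩ C).ncard) ∧ (δ ∉ B → Even (A δ ∩ C).ncard) := by
  let C : Set Omega1.{u} := {x | ∃ p ∈ G, x ∈ p.pts}
  let D : Set Omega1.{u} := {x | x ∈ C ∧ Order.IsSuccLimit x}
  have hgap : ∀ x ∈ C, ∀ p ∈ G, ∀ g ∈ p.gaps, g.1 < x → ¬ x ≤ g.2 := by
    rintro x ⟨q, hq, hx⟩ p hp g hg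
    obtain ⟨r, -, hrp, hrq⟩ := hdir p hp q hq
    exact r.notMem_gap x (hrq.1 hx) g (hrp.2.1 hg)
  have hlub : ∀ s ⊆ C, ∀ a, IsLUB s a → a ∈ C := by
    intro s hs a ha
    obtain ⟨p, hp, -, ⟨h, -⟩ | ⟨g, hg, h1, h2⟩⟩ := hG a
    · exact ⟨p, hp, h⟩
    · obtain ⟨x, hx, hgx⟩ := (lt_isLUB_iff ha).1 h1
      exact absurd ((ha.1 hx).trans h2) (hgap x (hs hx) p hp g hg hgx)
  have hcof : IsCofinal D := by
    intro γ
    obtain ⟨p, hp, ⟨ξ, hξ, hγξ, hlim⟩, -⟩ := hG γ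
    exact ⟨ξ, ⟨⟨p, hp, hξ⟩, hlim⟩, hγξ⟩
  refine ⟨C, D, ⟨fun s hs _ _ a ha => hlub s hs a ha, hcof.mono fun x hx => hx.1⟩,
    ⟨fun s hs hne _ a ha => ⟨hlub s (fun x hx => (hs hx).1) a ha, ?_⟩, hcof⟩, ?_⟩
  · by_cases has : a ∈ s
    · exact (hs has).2
    · exact ha.isSuccLimit_of_notMem hne has
  · rintro δ ⟨hδC, hδ⟩
    obtain ⟨p, hp, -, ⟨-, hdec⟩ | ⟨g, hg, h1, h2⟩⟩ := hG δ
    · have hAC : A δ ∩ C = A δ ∩ p.pts := by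
        ext x
        constructor
        · rintro ⟨hxA, q, hq, hx⟩
          obtain ⟨r, -, hrp, hrq⟩ := hdir p hp q hq
          exact ⟨hxA, hrp.2.2.2 δ (hdec hδ) x hxA (hrq.1 hx)⟩
        · exact fun hx => ⟨hx.1, p, hp, hx.2⟩
      have hpar := p.parity δ (hdec hδ)
      rw [hAC]
      exact ⟨hδ, p.pts.finite_toSet.subset Set.inter_subset_right, hpar.1,
        fun h => Nat.not_odd_iff_even.1 fun h' => h (hpar.2 h')⟩
    · exact absurd h2 (hgap δ hδC p hp g hg h1)

end CodingCondition

theorem proposition4p2 : PFAStar.{u} → CodeEvenOdd.{u} := by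
  intro hPFA A hA B
  obtain ⟨e⟩ := CodingCondition.nonempty_equiv A B
  obtain ⟨z, -⟩ := Omega1.exists_forall_lt.{u} Set.countable_empty
  have : Nonempty (CodingCondition A B) := ⟨e.symm z⟩
  obtain ⟨G, hdir, hG⟩ := hPFA.exists_generic e (fun α p => α ∈ p.pts)
    (fun α => ∀ p, e p < α → p.Below α) (fun α x y hxy h => (CodingCondition.le_def.1 hxy).1 h)
    (fun F hF hcl x hx => x.exists_le_subset_pts hA hF fun α hα => hcl α hα x (hx α hα))
    (CodingCondition.exists_club_predense hA e)
    (fun γ => {p | p.Decides γ}) (CodingCondition.exists_decides hA)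
  exact CodingCondition.exists_clubs_of_generic hdir hG
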